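/- Let $\mathbb K$ be an algebraically closed field of characteristic zero, let $S=\mathbb K[x_1,\dots,x_n]$, and let $R=\mathbb K[X_1,\dots,X_n]$ act on $S$ by partial differentiation, $\Phi\circ f=\Phi(\partial/\partial x_1,\dots,\partial/\partial x_n)f$. For $f\in S$ put $\mathrm{Ann}_R(f)=\{\Phi\in R:\Phi\circ f=0\}$ (the apolar ideal); the apolar algebra of $f$ is $R/\mathrm{Ann}_R(f)$. An ideal of $R$ is called a complete intersection if it is a proper ideal generated by a regular sequence of forms, and then the quotient of $R$ by it is also called a complete intersection. (1) Suppose that $S\cong S_1\otimes_{\mathbb K}\cdots\otimes_{\mathbb K}S_k$ as graded $\mathbb K$-algebras, where each $S_i$ is a (standard graded) polynomial ring in one or two variables; that is, after a linear change of coordinates the variables of $S$ are divided into $k$ disjoint sets of one or two variables each. If a nonzero form $f\in S$ factors as $f=f_1\cdots f_k$ with $f_i\in S_i$ for $i=1,\dots,k$, then $\mathrm{Ann}_R(f)$ is a complete intersection. (2) A (central) multi-arrangement in a finite-dimensional vector space $V$ is a finite set $\mathcal A$ of linear hyperplanes of $V$ with a multiplicity $\mathbf m(H)\ge 1$ for each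 $H\in\mathcal A$; if $V=\mathbb K^n$, its defining polynomial is $\prod_{H\in\mathcal A}\alpha_H^{\mathbf m(H)}$, where $\alpha_H$ is a linear form with zero set $H$. The product of multi-arrangements $(\mathcal A_i,\mathbf m_i)$ in $V_i$, $i=1,\dots,k$, is the multi-arrangement in $V_1\times\cdots\times V_k$ whose hyperplanes are the sets $\{v: v_i\in H\}$ with $1\le i\le k$ and $H\in\mathcal A_i$, with multiplicity $\mathbf m_i(H)$. If a multi-arrangement in $\mathbb K^n$ is, after a linear change of coordinates, a product of multi-arrangements in vector spaces of dimension one or two, then for each of its defining polynomials $f$ the apolar algebra $R/\mathrm{Ann}_R(f)$ is a complete intersection. -/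

import Mathlib

namespace Apolarity

noncomputable section

open MvPolynomial
open scoped IsMulCommutative

variable {K : Type*} [Field K] {σ : Type*}

/-- The partial derivative `∂/∂xᵢ` as a `K`-linear endomorphism of `K[x]`. -/
def partialOp (i : σ) : Module.End K (MvPolynomial σ K) :=
  (pderiv i : Derivation K (MvPolynomial σ K) (MvPolynomial σ K)).toLinearMap

theorem partialOp_apply (i : σ) (f : MvPolynomial σ K) :
    partialOp i f = pderiv i f := rfl

/-- Partial derivatives commute. -/
theorem partialOp_commute (i j : σ) :
    (partialOp i * partialOp j : Module.End K (MvPolynomial σ K)) =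
      partialOp j * partialOp i := by
  classical
  have h : ⁅(pderiv i : Derivation K (MvPolynomial σ K) (MvPolynomial σ K)),
      (pderiv j : Derivation K (MvPolynomial σ K) (MvPolynomial σ K))⁆ = 0 := by
    apply MvPolynomial.derivation_ext
    intro l
    rw [Derivation.commutator_apply]
    simp only [pderiv_X, Pi.single_apply]
    split_ifs <;> simp
  apply LinearMap.ext
  intro f
  have hf := congrArg
    (fun D : Derivation K (MvPolynomial σ K) (MvPolynomial σ K) => D f) h
  simp only [Derivation.commutator_apply, Derivation.coe_zero, Pi.zero_apply] at hf
  exact sub_eq_zero.mp hf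

/-- The commutative `K`-algebra of differential operators generated by the partials. -/
abbrev diffOps (σ K : Type*) [Field K] : Subalgebra K (Module.End K (MvPolynomial σ K)) :=
  Algebra.adjoin K (Set.range (partialOp : σ → Module.End K (MvPolynomial σ K)))

instance isMulCommutative_diffOps (σ K : Type*) [Field K] : IsMulCommutative (diffOps σ K) :=
  Algebra.isMulCommutative_adjoin K (by
    rintro _ ⟨i, rfl⟩ _ ⟨j, rfl⟩
    exact partialOp_commute i j)

/-- The apolar action: `Φ ↦ Φ(∂/∂x)`, the algebra homomorphism `R → End_K(S)` that sends
the variable `Xᵢ` to `∂/∂xᵢ`.  Both `R` and `S` are `MvPolynomial σ K`;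
`apolarAction Φ f` is `Φ ∘ f`. -/
def apolarAction : MvPolynomial σ K →ₐ[K] Module.End K (MvPolynomial σ K) :=
  (diffOps σ K).val.comp
    (aeval (R := K) (S₁ := diffOps σ K) fun i =>
      ⟨partialOp i, Algebra.subset_adjoin (Set.mem_range_self i)⟩)

theorem apolarAction_X (i : σ) (f : MvPolynomial σ K) :
    apolarAction (X i) f = pderiv i f := by
  simp only [apolarAction, AlgHom.comp_apply]
  rw [aeval_X]
  rfl

/-- The apolar ideal `Ann_R(f) = {Φ ∈ R : Φ ∘ f = 0}`. -/
def apolarIdeal (f : MvPolynomial σ K) : Ideal (MvPolynomial σ K) where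
  carrier := {Φ | apolarAction Φ f = 0}
  add_mem' := by
    intro a b ha hb
    simp only [Set.mem_ofPred_eq] at ha hb ⊢
    rw [map_add, LinearMap.add_apply, ha, hb, add_zero]
  zero_mem' := by simp
  smul_mem' := by
    intro c x hx
    simp only [Set.mem_ofPred_eq] at hx ⊢
    rw [smul_eq_mul, map_mul, Module.End.mul_apply, hx, map_zero]

/-- An ideal of the standard graded polynomial ring `R` is a complete intersection if it is
generated by a regular sequence of forms (regularity includes that the ideal is proper). -/
def IsCompleteIntersection (I : Ideal (MvPolynomial σ K)) : Prop :=
  ∃ rs : List (MvPolynomial σ K),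
    (∀ r ∈ rs, ∃ d : ℕ, r.IsHomogeneous d) ∧
    RingTheory.Sequence.IsRegular (MvPolynomial σ K) rs ∧
    I = Ideal.ofList rs

/-- A (central) multi-arrangement in a vector space `V`: finitely many linear hyperplanes,
each with a positive multiplicity.  It is recorded by the finitely supported multiplicity
function, whose support is the underlying arrangement. -/
structure MultiArrangement (K V : Type*) [Field K] [AddCommGroup V] [Module K V] where
  /-- the multiplicity of each subspace (zero off the arrangement) -/
  mult : Submodule K V →₀ ℕ
  /-- the subspaces that occur are hyperplanes, that is, maximal proper subspaces -/
  isHyperplane : ∀ H ∈ mult.support, IsCoatom H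

namespace MultiArrangement

variable {V W : Type*} [AddCommGroup V] [Module K V] [AddCommGroup W] [Module K W]

theorem isCoatom_of_mem_support_mapDomain (A : MultiArrangement K W) (g : V →ₗ[K] W)
    (hg : Function.Surjective g) (H : Submodule K V)
    (hH : H ∈ (A.mult.mapDomain (Submodule.comap g)).support) : IsCoatom H := by
  classical
  obtain ⟨G, hG, rfl⟩ := Finset.mem_image.mp (Finsupp.mapDomain_support hH)
  exact (Submodule.isCoatom_comap_iff hg).mpr (A.isHyperplane G hG)

/-- The inverse image of a multi-arrangement in `W` under a surjective linear map `V → W`: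
the hyperplane `g⁻¹(H)` gets the multiplicity of `H`.  For an isomorphism `g` this is the
multi-arrangement after a linear change of coordinates. -/
def comap (A : MultiArrangement K W) (g : V →ₗ[K] W) (hg : Function.Surjective g) :
    MultiArrangement K V where
  mult := A.mult.mapDomain (Submodule.comap g)
  isHyperplane := A.isCoatom_of_mem_support_mapDomain g hg

/-- The product of finitely many multi-arrangements `Bᵢ` in `Vᵢ`: its hyperplanes in `∏ Vᵢ`
are the `{v | vᵢ ∈ H}` for `H` in `Bᵢ`, and such a hyperplane has multiplicity `mᵢ(H)`. -/
def pi {k : ℕ} {U : Fin k → Type*} [∀ i, AddCommGroup (U i)] [∀ i, Module K (U i)]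
    (B : ∀ i, MultiArrangement K (U i)) : MultiArrangement K (∀ i, U i) where
  mult := ∑ i, ((B i).comap (LinearMap.proj i : (∀ i, U i) →ₗ[K] U i)
    (LinearMap.proj_surjective i)).mult
  isHyperplane := by
    classical
    intro H hH
    obtain ⟨i, -, hi⟩ := Finset.mem_biUnion.mp (Finsupp.support_finsetSum hH)
    exact MultiArrangement.isHyperplane _ H hi

/-- `f` is a defining polynomial `∏_H α_H ^ m(H)` of the multi-arrangement `A` in `K^σ`,
for some choice of linear forms `α_H` whose zero sets are the hyperplanes `H` of `A`. -/
def IsDefiningPolynomial (A : MultiArrangement K (σ → K)) (f : MvPolynomial σ K) : Prop :=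
  ∃ α : Submodule K (σ → K) → MvPolynomial σ K,
    (∀ H ∈ A.mult.support,
      (α H).IsHomogeneous 1 ∧ ∀ v : σ → K, eval v (α H) = 0 ↔ v ∈ H) ∧
    f = ∏ H ∈ A.mult.support, α H ^ A.mult H

end MultiArrangement

end

end Apolarity

namespace Apolarity

noncomputable section

open MvPolynomial
open scoped TensorProduct

variable {K : Type*} [Field K] {σ τ : Type*}

/-! The annihilator of a nonzero form in one variable is `(X ^ (d + 1))`. For a nonzero binary form
`g` it is generated by two forms, by induction on the degree. Let `∂ᵢ g ≠ 0` and `Ann (∂ᵢ g) = (φ,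
ψ)`, and let `Ψ` be a form of least degree in `Ann g` that is not divisible by `Xᵢ`. Then `Ψ` lies
in `Ann (∂ᵢ g)` but not in `𝔪 Ann (∂ᵢ g)`, so it can replace one of the two generators. Since `Xᵢ Θ
∈ Ann g` exactly when `Θ ∈ Ann (∂ᵢ g)`, multiplying the other generator by `Xᵢ` gives generators of
`Ann g` (`exists_span_pair_of_pderiv`). The two generators are coprime, because the ideal contains
powers of both variables, and so they form a regular sequence.

For `f` and `g` in disjoint sets of variables, `Φ ↦ Φ ∘ (f g)` is the tensor product of the
evaluations at `f` and at `g`. Over a field its kernel is the sum of the extensions of `Ann f` and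
`Ann g` (`apolarIdeal_rename_mul_rename`), and by flatness the two regular sequences concatenate
(`isWeaklyRegular_tmul_append`). A linear change of coordinates acts on operators through the
transpose (`apolarAction_algHom`). Factors of a form are forms, which gives (1).

For (2), a linear form whose zero set is pulled back from one factor involves only the variables of
that factor. Hence a defining polynomial factors as in (1). -/

/-! ### The apolar action on coefficients and degrees. -/

theorem mem_apolarIdeal {f Φ : MvPolynomial σ K} :
    Φ ∈ apolarIdeal f ↔ apolarAction Φ f = 0 := Iff.rfl

theorem apolarAction_mul_apply (Φ Ψ f : MvPolynomial σ K) :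
    apolarAction (Φ * Ψ) f = apolarAction Φ (apolarAction Ψ f) := by
  rw [map_mul, Module.End.mul_apply]

theorem apolarAction_C_apply (c : K) (f : MvPolynomial σ K) :
    apolarAction (C c) f = C c * f := by
  have : (C c : MvPolynomial σ K) = algebraMap K _ c := rfl
  rw [this, AlgHom.commutes, Module.algebraMap_end_apply, ← this, C_mul']

theorem X_mul_mem_apolarIdeal {f Φ : MvPolynomial σ K} {i : σ} :
    X i * Φ ∈ apolarIdeal f ↔ Φ ∈ apolarIdeal (pderiv i f) := by
  rw [mem_apolarIdeal, mem_apolarIdeal, mul_comm, apolarAction_mul_apply, apolarAction_X]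

theorem apolarIdeal_le_pderiv (f : MvPolynomial σ K) (i : σ) :
    apolarIdeal f ≤ apolarIdeal (pderiv i f) := fun _ h =>
  X_mul_mem_apolarIdeal.mp (Ideal.mul_mem_left _ _ h)

theorem apolarIdeal_ne_top {f : MvPolynomial σ K} (hf : f ≠ 0) : apolarIdeal f ≠ ⊤ := by
  rw [Ne, Ideal.eq_top_iff_one, mem_apolarIdeal, map_one, Module.End.one_apply]
  exact hf

theorem degree_eq_of_coeff_ne_zero {f : MvPolynomial σ K} {d : ℕ} (hf : f.IsHomogeneous d)
    {m : σ →₀ ℕ} (hm : coeff m f ≠ 0) : m.degree = d := by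
  by_contra h
  exact hm (hf.coeff_eq_zero h)

/-- The coefficients of a monomial differential operator applied to a polynomial. -/
theorem exists_coeff_apolarAction_monomial [CharZero K] (s m : σ →₀ ℕ) :
    ∃ N : K, N ≠ 0 ∧ ∀ f : MvPolynomial σ K,
      coeff m (apolarAction (monomial s 1) f) = coeff (m + s) f * N := by
  -- The scalar `N` is `(m + s)! / m!` in multi-index notation, nonzero in characteristic zero.
  induction s using Finsupp.induction_linear generalizing m with
  | zero =>
    refine ⟨1, one_ne_zero, fun f => ?_⟩
    rw [← C_apply, apolarAction_C_apply]
    simp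
  | add s t hs ht =>
    obtain ⟨N, hN, h⟩ := hs m
    obtain ⟨M, hM, h'⟩ := ht (m + s)
    refine ⟨M * N, mul_ne_zero hM hN, fun f => ?_⟩
    have : (monomial (s + t) 1 : MvPolynomial σ K) = monomial s 1 * monomial t 1 := by
      rw [monomial_mul, one_mul]
    rw [this, apolarAction_mul_apply, h, h', mul_assoc, add_assoc]
  | single i n =>
    induction n generalizing m with
    | zero =>
      refine ⟨1, one_ne_zero, fun f => ?_⟩
      rw [Finsupp.single_zero, ← C_apply, apolarAction_C_apply]
      simp
    | succ n ih =>
      obtain ⟨N, hN, h⟩ := ih (m + Finsupp.single i 1)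
      refine ⟨N * (m i + 1), mul_ne_zero hN (by exact_mod_cast (Nat.succ_ne_zero (m i))),
        fun f => ?_⟩
      have : (monomial (Finsupp.single i (n + 1)) 1 : MvPolynomial σ K) =
          X i * monomial (Finsupp.single i n) 1 := by
        rw [X, monomial_mul, one_mul, add_comm, Finsupp.single_add]
      rw [this, apolarAction_mul_apply, apolarAction_X, coeff_pderiv, h, mul_assoc, add_assoc,
        ← Finsupp.single_add, add_comm 1 n]

theorem apolarAction_eq_sum (Φ f : MvPolynomial σ K) :
    apolarAction Φ f = ∑ s ∈ Φ.support, C (coeff s Φ) * apolarAction (monomial s 1) f := by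
  conv_lhs => rw [Φ.as_sum]
  rw [map_sum, LinearMap.sum_apply]
  refine Finset.sum_congr rfl fun s _ => ?_
  rw [← apolarAction_C_apply, ← apolarAction_mul_apply, C_mul_monomial, mul_one]

theorem exists_coeff_ne_zero_of_apolarAction [CharZero K] {Φ f : MvPolynomial σ K} {m : σ →₀ ℕ}
    (h : coeff m (apolarAction Φ f) ≠ 0) : ∃ s, coeff s Φ ≠ 0 ∧ coeff (m + s) f ≠ 0 := by
  rw [apolarAction_eq_sum, coeff_sum] at h
  obtain ⟨s, hs, h⟩ := Finset.exists_ne_zero_of_sum_ne_zero h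
  obtain ⟨N, -, hN⟩ := exists_coeff_apolarAction_monomial (K := K) s m
  rw [coeff_C_mul, hN] at h
  exact ⟨s, mem_support_iff.mp hs, left_ne_zero_of_mul (right_ne_zero_of_mul h)⟩

theorem isHomogeneous_apolarAction [CharZero K] {Φ f : MvPolynomial σ K} {e d : ℕ}
    (hΦ : Φ.IsHomogeneous (e)) (hf : f.IsHomogeneous (d + e)) :
    (apolarAction Φ f).IsHomogeneous d := by
  intro m hm
  obtain ⟨s, hs, hms⟩ := exists_coeff_ne_zero_of_apolarAction hm
  have h1 := hΦ hs
  have h2 := hf hms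
  rw [map_add, h1] at h2
  omega

theorem apolarAction_eq_zero_of_lt [CharZero K] {Φ f : MvPolynomial σ K} {e d : ℕ}
    (hΦ : Φ.IsHomogeneous e) (hf : f.IsHomogeneous d) (h : d < e) :
    apolarAction Φ f = 0 := by
  ext m
  by_contra hm
  obtain ⟨s, hs, hms⟩ := exists_coeff_ne_zero_of_apolarAction hm
  have h1 := hΦ hs
  have h2 := hf hms
  rw [map_add, h1] at h2
  omega

/-- The apolar ideal of a form is homogeneous. -/
theorem homogeneousComponent_mem_apolarIdeal [CharZero K] {f : MvPolynomial σ K} {d : ℕ}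
    (hf : f.IsHomogeneous d) {Φ : MvPolynomial σ K} (hΦ : Φ ∈ apolarIdeal f) (e : ℕ) :
    homogeneousComponent e Φ ∈ apolarIdeal f := by
  rcases lt_or_ge d e with h | h
  · exact apolarAction_eq_zero_of_lt (homogeneousComponent_isHomogeneous e Φ) hf h
  · obtain ⟨k, rfl⟩ := Nat.exists_eq_add_of_le' h
    -- A component of `Φ` of degree `j` either kills `f` or lands in degree `k + e - j`, so only `j
    -- = e` contributes in degree `k`.
    have key : homogeneousComponent k (apolarAction Φ f) =
        apolarAction (homogeneousComponent e Φ) f := by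
      conv_lhs => rw [← sum_homogeneousComponent Φ]
      rw [map_sum, LinearMap.sum_apply, map_sum, Finset.sum_eq_single e]
      · exact homogeneousComponent_eq_self
          (isHomogeneous_apolarAction (homogeneousComponent_isHomogeneous e Φ) hf)
      · intro j _ hj
        rcases lt_or_ge (k + e) j with hlt | hle
        · rw [apolarAction_eq_zero_of_lt (homogeneousComponent_isHomogeneous j Φ) hf hlt, map_zero]
        · obtain ⟨l, hl⟩ := Nat.exists_eq_add_of_le' hle
          rw [homogeneousComponent_of_mem (isHomogeneous_apolarAction
            (homogeneousComponent_isHomogeneous j Φ) (hl ▸ hf)), if_neg (by omega)]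
      · intro he
        have : homogeneousComponent e Φ = 0 := homogeneousComponent_eq_zero _ _ (by simpa using he)
        rw [this, map_zero, LinearMap.zero_apply, map_zero]
    rw [mem_apolarIdeal, ← key, mem_apolarIdeal.mp hΦ, map_zero]

/-- A nonzero form of degree `d` is sent to a nonzero constant by some form of degree `d`. -/
theorem exists_apolarAction_eq_C [CharZero K] {f : MvPolynomial σ K} {d : ℕ}
    (hf : f.IsHomogeneous d) (h0 : f ≠ 0) :
    ∃ (Φ : MvPolynomial σ K), Φ.IsHomogeneous d ∧ apolarAction Φ f = 1 := by
  obtain ⟨s, hs⟩ := ne_zero_iff.mp h0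
  obtain ⟨N, hN, h⟩ := exists_coeff_apolarAction_monomial (K := K) s 0
  have hd : s.degree = d := degree_eq_of_coeff_ne_zero hf hs
  have hm : (monomial s 1 : MvPolynomial σ K).IsHomogeneous d := isHomogeneous_monomial _ hd
  refine ⟨C (coeff s f * N)⁻¹ * monomial s 1, hm.C_mul _, ?_⟩
  have hc := isHomogeneous_apolarAction (d := 0) (f := f) hm (by rwa [zero_add])
  rw [← totalDegree_zero_iff_isHomogeneous, totalDegree_eq_zero_iff_eq_C] at hc
  rw [apolarAction_mul_apply, apolarAction_C_apply, hc, h, zero_add, ← C_mul,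
    inv_mul_cancel₀ (mul_ne_zero hs hN), C_1]

theorem eq_C_of_forall_pderiv_eq_zero [CharZero K] {f : MvPolynomial σ K}
    (h : ∀ i, pderiv i f = 0) : f = C (coeff 0 f) := by
  classical
  ext m
  rw [coeff_C]
  split_ifs with hm
  · rw [hm]
  · obtain ⟨i, hi⟩ := DFunLike.ne_iff.mp (Ne.symm hm)
    have := congrArg (coeff (m - Finsupp.single i 1)) (h i)
    have hle : Finsupp.single i 1 ≤ m := by
      rw [Finsupp.single_le_iff]; exact Nat.one_le_iff_ne_zero.mpr hi
    rw [coeff_pderiv, tsub_add_cancel_of_le hle, coeff_zero, mul_eq_zero] at this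
    exact this.resolve_right (Nat.cast_add_one_ne_zero _)

/-! ### Binary forms: two generators for the apolar ideal. -/

theorem coeff_single_X_mul {i j : σ} (hij : i ≠ j) (t : ℕ) (p : MvPolynomial σ K) :
    coeff (Finsupp.single j t) (X i * p) = 0 := by
  classical
  rw [coeff_X_mul', if_neg]
  rw [Finsupp.mem_support_iff, Finsupp.single_eq_of_ne hij, not_not]

theorem coeff_single_succ_X_mul (j : σ) (t : ℕ) (p : MvPolynomial σ K) :
    coeff (Finsupp.single j (t + 1)) (X j * p) = coeff (Finsupp.single j t) p := by
  rw [add_comm t 1, Finsupp.single_add, coeff_X_mul]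

/-- With only two variables, a monomial not divisible by `X i` is a power of `X j`. The coefficient
of `X j ^ e` is thus all that survives modulo `X i`. -/
theorem X_dvd_of_coeff_single_eq_zero {i j : σ} (hσ : ∀ l, l = i ∨ l = j)
    {p : MvPolynomial σ K} {e : ℕ} (hp : p.IsHomogeneous e)
    (h : coeff (Finsupp.single j e) p = 0) : X i ∣ p := by
  classical
  rw [X_dvd_iff_modMonomial_eq_zero]
  ext m
  rw [coeff_zero]
  by_cases hm : Finsupp.single i 1 ≤ m
  · exact coeff_modMonomial_of_le _ hm
  rw [coeff_modMonomial_of_not_le _ hm]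
  by_contra hne
  have hmi : m i = 0 := by
    rw [Finsupp.single_le_iff] at hm
    omega
  have hm' : m = Finsupp.single j (m j) := by
    ext l
    by_cases hl : l = j
    · rw [hl, Finsupp.single_eq_same]
    · rw [Finsupp.single_eq_of_ne hl, (hσ l).resolve_right hl, hmi]
  have := degree_eq_of_coeff_ne_zero hp hne
  rw [hm', Finsupp.degree_single] at this
  rw [← this, ← hm'] at h
  exact hne h

/-- The case `i = j` is allowed and serves forms in one variable. -/
theorem exists_eq_X_mul_add_X_mul {i j : σ} (hσ : ∀ l, l = i ∨ l = j) {p : MvPolynomial σ K}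
    (h : coeff 0 p = 0) : ∃ a b, p = X i * a + X j * b := by
  have : p ∈ Ideal.span (X '' {i, j} : Set (MvPolynomial σ K)) := by
    rw [mem_ideal_span_X_image]
    intro m hm
    have : m ≠ 0 := by
      rintro rfl
      exact mem_support_iff.mp hm h
    obtain ⟨l, hl⟩ := DFunLike.ne_iff.mp this
    exact ⟨l, hσ l, hl⟩
  rw [Set.image_pair, Ideal.mem_span_pair] at this
  obtain ⟨a, b, rfl⟩ := this
  exact ⟨a, b, by ring⟩

/-- The multiplier `b` is the component of `a` of degree `t - e`, or `0` if `t < e`. The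
alternative, unit or element of `𝔪`, decides below which generator can be exchanged. -/
theorem exists_homogeneousComponent_mul_eq {p : MvPolynomial σ K} {e : ℕ}
    (hp : p.IsHomogeneous e) (a : MvPolynomial σ K) (t : ℕ) :
    ∃ b, homogeneousComponent t (a * p) = b * p ∧ ((∃ c, c ≠ 0 ∧ b = C c) ∨ coeff 0 b = 0) := by
  rcases lt_or_ge t e with h | h
  · refine ⟨0, ?_, Or.inr (coeff_zero _)⟩
    rw [zero_mul]
    conv_lhs => rw [← sum_homogeneousComponent a]
    rw [Finset.sum_mul, map_sum]
    refine Finset.sum_eq_zero fun k _ => ?_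
    rw [homogeneousComponent_of_mem ((homogeneousComponent_isHomogeneous k a).mul hp),
      if_neg (by omega)]
  · obtain ⟨l, rfl⟩ := Nat.exists_eq_add_of_le' h
    refine ⟨homogeneousComponent l a, ?_, ?_⟩
    · conv_lhs => rw [← sum_homogeneousComponent a]
      rw [Finset.sum_mul, map_sum, Finset.sum_eq_single l]
      · exact homogeneousComponent_eq_self ((homogeneousComponent_isHomogeneous l a).mul hp)
      · intro k _ hk
        rw [homogeneousComponent_of_mem ((homogeneousComponent_isHomogeneous k a).mul hp),
          if_neg (by omega)]
      · intro hl
        have : homogeneousComponent l a = 0 := homogeneousComponent_eq_zero _ _ (by simpa using hl)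
        rw [this, zero_mul, map_zero]
    · rcases Nat.eq_zero_or_pos l with rfl | hl
      · rw [homogeneousComponent_zero]
        by_cases h0 : coeff 0 a = 0
        · exact Or.inr (by rw [h0, C_0, coeff_zero])
        · exact Or.inl ⟨_, h0, rfl⟩
      · refine Or.inr ((homogeneousComponent_isHomogeneous l a).coeff_eq_zero ?_)
        rw [map_zero]
        exact hl.ne

theorem span_pair_le_of_mem {I : Ideal (MvPolynomial σ K)} {p q : MvPolynomial σ K}
    (hp : p ∈ I) (hq : q ∈ I) : Ideal.span {p, q} ≤ I := by
  rw [Ideal.span_le]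
  rintro x (rfl | rfl)
  · exact hp
  · exact hq

/-- If `Ann (∂ᵢ g) = (φ, ψ)`, where `ψ` is a form in `Ann g` of least degree not divisible by
`Xᵢ`, then `Ann g = (Xᵢ φ, ψ)`. -/
theorem apolarIdeal_eq_span_pair_of_pderiv [CharZero K] {i j : σ} (hσ : ∀ l, l = i ∨ l = j)
    {g : MvPolynomial σ K} {d : ℕ} (hg : g.IsHomogeneous d)
    {φ ψ : MvPolynomial σ K} {t : ℕ}
    (hψ : ψ ∈ apolarIdeal g) (hψt : ψ.IsHomogeneous t)
    (hψ0 : coeff (Finsupp.single j t) ψ ≠ 0)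
    (hmin : ∀ s < t, ∀ Φ ∈ apolarIdeal g, coeff (Finsupp.single j s) Φ = 0)
    (h : apolarIdeal (pderiv i g) = Ideal.span {φ, ψ}) :
    apolarIdeal g = Ideal.span {X i * φ, ψ} := by
  apply le_antisymm
  · intro Φ hΦ
    rw [← sum_homogeneousComponent Φ]
    refine Ideal.sum_mem _ fun e _ => ?_
    have hΦe := homogeneousComponent_mem_apolarIdeal hg hΦ e
    have hhom := homogeneousComponent_isHomogeneous e Φ
    set Ψ := homogeneousComponent e Φ
    have hX : ∀ Θ, X i * Θ ∈ apolarIdeal g → X i * Θ ∈ Ideal.span {X i * φ, ψ} := by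
      intro Θ hΘ
      rw [X_mul_mem_apolarIdeal, h, Ideal.mem_span_pair] at hΘ
      obtain ⟨a, b, rfl⟩ := hΘ
      exact Ideal.mem_span_pair.mpr ⟨a, X i * b, by ring⟩
    rcases lt_or_ge e t with hlt | hge
    · obtain ⟨Θ, hΘ⟩ := X_dvd_of_coeff_single_eq_zero hσ hhom (hmin e hlt Ψ hΦe)
      rw [hΘ] at hΦe ⊢
      exact hX Θ hΦe
    · obtain ⟨k, rfl⟩ := Nat.exists_eq_add_of_le' hge
      -- This multiple of `ψ` has the same coefficient at `X j ^ (k + t)` as `Ψ`, so the difference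
      -- is divisible by `X i` and `hX` applies.
      have hmem : C (coeff (Finsupp.single j (k + t)) Ψ / coeff (Finsupp.single j t) ψ) *
          X j ^ k * ψ ∈ Ideal.span {X i * φ, ψ} :=
        Ideal.mul_mem_left _ _ (Ideal.subset_span (by simp))
      have hmem' : C (coeff (Finsupp.single j (k + t)) Ψ / coeff (Finsupp.single j t) ψ) *
          X j ^ k * ψ ∈ apolarIdeal g := Ideal.mul_mem_left _ _ hψ
      have hc : coeff (Finsupp.single j (k + t)) (X j ^ k * ψ) = coeff (Finsupp.single j t) ψ := by
        rw [X_pow_eq_monomial, Finsupp.single_add, coeff_monomial_mul, one_mul]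
      have hdiv := X_dvd_of_coeff_single_eq_zero (p := Ψ - C (coeff (Finsupp.single j (k + t)) Ψ /
          coeff (Finsupp.single j t) ψ) * X j ^ k * ψ) hσ (e := k + t)
        (hhom.sub (by
          rw [mul_assoc]
          exact (((isHomogeneous_X_pow j k)).mul hψt).C_mul _))
        (by rw [coeff_sub, mul_assoc, coeff_C_mul, hc, div_mul_cancel₀ _ hψ0, sub_self])
      obtain ⟨Θ, hΘ⟩ := hdiv
      rw [← sub_add_cancel Ψ, hΘ]
      refine Ideal.add_mem _ (hX Θ ?_) hmem
      rw [← hΘ]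
      exact Ideal.sub_mem _ hΦe hmem'
  · refine span_pair_le_of_mem ?_ hψ
    rw [X_mul_mem_apolarIdeal, h]
    exact Ideal.subset_span (by simp)

/-- A form of least degree in `Ann g` not divisible by `Xᵢ` is not in `𝔪 Ann (∂ᵢ g)`. -/
theorem ne_X_mul_add_X_mul_of_minimal [CharZero K] {i j : σ} (hσ : ∀ l, l = i ∨ l = j)
    (hij : i ≠ j) {g : MvPolynomial σ K} {d : ℕ} (hg : g.IsHomogeneous (d + 1))
    (hg' : pderiv i g ≠ 0) {ψ η θ : MvPolynomial σ K} {t : ℕ}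
    (hψ : ψ ∈ apolarIdeal g)
    (hψ0 : coeff (Finsupp.single j t) ψ ≠ 0)
    (hmin : ∀ s < t, ∀ Φ ∈ apolarIdeal g, coeff (Finsupp.single j s) Φ = 0)
    (hη : η ∈ apolarIdeal (pderiv i g)) (hθ : θ ∈ apolarIdeal (pderiv i g)) :
    ψ ≠ X i * η + X j * θ := by
  intro heq
  have hθg : X j * θ ∈ apolarIdeal g := by
    have : X j * θ = ψ - X i * η := by rw [heq]; ring
    rw [this]
    exact Ideal.sub_mem _ hψ (X_mul_mem_apolarIdeal.mpr hη)
  rcases t with _ | t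
  · rw [heq, Finsupp.single_zero] at hψ0
    rw [← constantCoeff_eq] at hψ0
    simp at hψ0
  · rw [heq, coeff_add, coeff_single_X_mul hij, zero_add, coeff_single_succ_X_mul] at hψ0
    -- Both `X i * θ` and `X j * θ` annihilate `g`, so all partial derivatives of `θ ∘ g` vanish.
    have hconst : apolarAction θ g = C (coeff 0 (apolarAction θ g)) := by
      apply eq_C_of_forall_pderiv_eq_zero
      intro l
      rw [← apolarAction_X, ← apolarAction_mul_apply]
      rcases hσ l with rfl | rfl
      · exact X_mul_mem_apolarIdeal.mpr hθ
      · exact hθg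
    obtain ⟨Φ, -, hΦ⟩ := exists_apolarAction_eq_C (hg.pderiv (i := i)) hg'
    set c := coeff 0 (apolarAction θ g)
    -- Subtracting a multiple of `X i` leaves the coefficient of `X j ^ t` unchanged. The result is
    -- an element of `Ann g` that contradicts the minimality of `t + 1`.
    have hmem : θ - C c * (X i * Φ) ∈ apolarIdeal g := by
      rw [mem_apolarIdeal, map_sub, LinearMap.sub_apply, apolarAction_mul_apply, mul_comm (X i),
        apolarAction_mul_apply, apolarAction_X, hΦ, apolarAction_C_apply, mul_one, hconst, sub_self]
    have := hmin t (Nat.lt_succ_self t) _ hmem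
    rw [coeff_sub, coeff_C_mul, coeff_single_X_mul hij, mul_zero, sub_zero] at this
    exact hψ0 this

/-- An exchange argument: a minimal `Ψ` in `Ann g`, written as `a * φ + b * ψ`, is not in `𝔪 (φ,
ψ)`. So `a` or `b` is a nonzero constant, and `Ψ` replaces the corresponding generator of `Ann (∂ᵢ
g)`. -/
theorem exists_span_pair_of_pderiv [CharZero K] {i j : σ} (hσ : ∀ l, l = i ∨ l = j)
    (hij : i ≠ j) {g : MvPolynomial σ K} {d : ℕ} (hg : g.IsHomogeneous (d + 1))
    (hg' : pderiv i g ≠ 0) {φ ψ : MvPolynomial σ K} {p q : ℕ} (hφ : φ.IsHomogeneous p)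
    (hψ : ψ.IsHomogeneous q) (h : apolarIdeal (pderiv i g) = Ideal.span {φ, ψ}) :
    ∃ (φ' ψ' : MvPolynomial σ K) (p' q' : ℕ), φ'.IsHomogeneous p' ∧ ψ'.IsHomogeneous q' ∧
      apolarIdeal g = Ideal.span {φ', ψ'} := by
  classical
  have hex : ∃ t, ∃ Φ ∈ apolarIdeal g, coeff (Finsupp.single j t) Φ ≠ 0 := by
    -- Any power of `X j` above the degree `d + 1` of `g` annihilates `g`.
    refine ⟨d + 2, X j ^ (d + 2), apolarAction_eq_zero_of_lt (isHomogeneous_X_pow j _) hg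
      (by omega), ?_⟩
    rw [X_pow_eq_monomial, coeff_monomial, if_pos rfl]
    exact one_ne_zero
  set t := Nat.find hex with ht
  have hmin : ∀ s < t, ∀ Φ ∈ apolarIdeal g, coeff (Finsupp.single j s) Φ = 0 := by
    intro s hs Φ hΦ
    by_contra hne
    exact Nat.find_min hex hs ⟨Φ, hΦ, hne⟩
  obtain ⟨Ψ₀, hΨ₀, hne₀⟩ := Nat.find_spec hex
  rw [← ht] at hne₀
  have hΨ := homogeneousComponent_mem_apolarIdeal hg hΨ₀ t
  have hΨt := homogeneousComponent_isHomogeneous t Ψ₀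
  have hne : coeff (Finsupp.single j t) (homogeneousComponent t Ψ₀) ≠ 0 := by
    rwa [coeff_homogeneousComponent, if_pos (Finsupp.degree_single j t)]
  set Ψ := homogeneousComponent t Ψ₀
  have hΨ' := apolarIdeal_le_pderiv g i hΨ
  rw [h, Ideal.mem_span_pair] at hΨ'
  obtain ⟨a₀, b₀, hab₀⟩ := hΨ'
  obtain ⟨a, ha, ha'⟩ := exists_homogeneousComponent_mul_eq hφ a₀ t
  obtain ⟨b, hb, hb'⟩ := exists_homogeneousComponent_mul_eq hψ b₀ t
  have hab : Ψ = a * φ + b * ψ := by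
    rw [← ha, ← hb, ← map_add, hab₀, homogeneousComponent_eq_self hΨt]
  have hΨmem : Ψ ∈ Ideal.span {φ, ψ} := h ▸ apolarIdeal_le_pderiv g i hΨ
  rcases ha' with ⟨c, hc, rfl⟩ | ha0
  -- Here `Ψ` replaces `φ`, so `ψ` is the generator that gets multiplied by `X i`.
  · refine ⟨X i * ψ, Ψ, _, _, (isHomogeneous_X K i).mul hψ, hΨt,
      apolarIdeal_eq_span_pair_of_pderiv hσ hg hΨ hΨt hne hmin (h.trans ?_)⟩
    refine le_antisymm (span_pair_le_of_mem ?_ (Ideal.subset_span (by simp)))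
      (span_pair_le_of_mem (Ideal.subset_span (by simp)) hΨmem)
    refine Ideal.mem_span_pair.mpr ⟨-C c⁻¹ * b, C c⁻¹, ?_⟩
    rw [hab, mul_add, ← mul_assoc, ← C_mul, inv_mul_cancel₀ hc, C_1]
    ring
  · rcases hb' with ⟨c, hc, rfl⟩ | hb0
    · refine ⟨X i * φ, Ψ, _, _, (isHomogeneous_X K i).mul hφ, hΨt,
        apolarIdeal_eq_span_pair_of_pderiv hσ hg hΨ hΨt hne hmin (h.trans ?_)⟩
      refine le_antisymm (span_pair_le_of_mem (Ideal.subset_span (by simp)) ?_)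
        (span_pair_le_of_mem (Ideal.subset_span (by simp)) hΨmem)
      refine Ideal.mem_span_pair.mpr ⟨-C c⁻¹ * a, C c⁻¹, ?_⟩
      rw [hab, mul_add, ← mul_assoc (C c⁻¹) (C c), ← C_mul, inv_mul_cancel₀ hc, C_1]
      ring
    · obtain ⟨a₁, a₂, rfl⟩ := exists_eq_X_mul_add_X_mul hσ ha0
      obtain ⟨b₁, b₂, rfl⟩ := exists_eq_X_mul_add_X_mul hσ hb0
      refine absurd ?_ (ne_X_mul_add_X_mul_of_minimal (η := a₁ * φ + b₁ * ψ)
        (θ := a₂ * φ + b₂ * ψ) hσ hij hg hg' hΨ hne hmin ?_ ?_)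
      · rw [hab]; ring
      · rw [h]; exact Ideal.mem_span_pair.mpr ⟨_, _, rfl⟩
      · rw [h]; exact Ideal.mem_span_pair.mpr ⟨_, _, rfl⟩

theorem coeff_zero_eq_zero_of_mem_apolarIdeal [CharZero K] {g Φ : MvPolynomial σ K} {d : ℕ}
    (hg : g.IsHomogeneous d) (h0 : g ≠ 0) (h : Φ ∈ apolarIdeal g) : coeff 0 Φ = 0 := by
  have := homogeneousComponent_mem_apolarIdeal hg h 0
  rw [homogeneousComponent_zero, mem_apolarIdeal, apolarAction_C_apply, mul_eq_zero, C_eq_zero]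
    at this
  exact this.resolve_right h0

/-- The apolar ideal of a nonzero binary form is generated by two forms. -/
theorem exists_apolarIdeal_eq_span_pair [CharZero K] {i j : σ} (hσ : ∀ l, l = i ∨ l = j)
    (hij : i ≠ j) {g : MvPolynomial σ K} {d : ℕ} (hg : g.IsHomogeneous d) (h0 : g ≠ 0) :
    ∃ (φ ψ : MvPolynomial σ K) (p q : ℕ), φ.IsHomogeneous p ∧ ψ.IsHomogeneous q ∧
      apolarIdeal g = Ideal.span {φ, ψ} := by
  induction d generalizing g with
  | zero =>
    refine ⟨X i, X j, 1, 1, isHomogeneous_X K i, isHomogeneous_X K j, le_antisymm ?_ ?_⟩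
    · intro Φ hΦ
      obtain ⟨a, b, rfl⟩ :=
        exists_eq_X_mul_add_X_mul hσ (coeff_zero_eq_zero_of_mem_apolarIdeal hg h0 hΦ)
      exact Ideal.mem_span_pair.mpr ⟨a, b, by ring⟩
    · exact span_pair_le_of_mem
        (apolarAction_eq_zero_of_lt (isHomogeneous_X K i) hg Nat.one_pos)
        (apolarAction_eq_zero_of_lt (isHomogeneous_X K j) hg Nat.one_pos)
  | succ d ih =>
    -- A nonzero form of positive degree has a nonzero partial derivative. The roles of `i` and `j`
    -- are symmetric.
    by_cases hi : pderiv i g = 0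
    · by_cases hj : pderiv j g = 0
      · have hC := eq_C_of_forall_pderiv_eq_zero (f := g) fun l => by
          rcases hσ l with rfl | rfl
          · exact hi
          · exact hj
        rw [hg.coeff_eq_zero (by rw [map_zero]; omega), C_0] at hC
        exact absurd hC h0
      · obtain ⟨φ, ψ, p, q, hφ, hψ, h⟩ := ih (hg.pderiv (i := j)) hj
        exact exists_span_pair_of_pderiv (fun l => (hσ l).symm) hij.symm hg hj hφ hψ h
    · obtain ⟨φ, ψ, p, q, hφ, hψ, h⟩ := ih (hg.pderiv (i := i)) hi
      exact exists_span_pair_of_pderiv hσ hij hg hi hφ hψ h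

/-! ### Complete intersections in one and two variables. -/

/-- In a factorial domain, two elements without common factor form a regular sequence. -/
theorem isRegular_pair_of_isRelPrime {R : Type*} [CommRing R] [IsDomain R] [DecompositionMonoid R]
    {φ ψ : R} (h : IsRelPrime φ ψ) (hφ : φ ≠ 0) (htop : Ideal.ofList [φ, ψ] ≠ ⊤) :
    RingTheory.Sequence.IsRegular R [φ, ψ] := by
  refine ⟨?_, by rw [smul_eq_mul, Ideal.mul_top]; exact htop.symm⟩
  rw [RingTheory.Sequence.isWeaklyRegular_cons_iff,
    RingTheory.Sequence.isWeaklyRegular_singleton_iff]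
  refine ⟨IsSMulRegular.of_ne_zero hφ, ?_⟩
  rw [isSMulRegular_iff_right_eq_zero_of_smul]
  intro x
  obtain ⟨x, rfl⟩ := Submodule.Quotient.mk_surjective _ x
  rw [← Submodule.Quotient.mk_smul, Submodule.Quotient.mk_eq_zero, Submodule.Quotient.mk_eq_zero,
    Submodule.mem_smul_pointwise_iff_exists, Submodule.mem_smul_pointwise_iff_exists]
  rintro ⟨y, -, hy⟩
  obtain ⟨z, rfl⟩ : φ ∣ x := h.dvd_of_dvd_mul_left ⟨y, by simpa using hy.symm⟩
  exact ⟨z, trivial, rfl⟩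

/-- The ideal contains `X i ^ (d + 1)` and `X j ^ (d + 1)`, so a common divisor of its two
generators divides both powers and is a unit. -/
theorem isCompleteIntersection_of_binary [CharZero K] {i j : σ} (hσ : ∀ l, l = i ∨ l = j)
    (hij : i ≠ j) {g : MvPolynomial σ K} {d : ℕ} (hg : g.IsHomogeneous d) (h0 : g ≠ 0) :
    IsCompleteIntersection (apolarIdeal g) := by
  obtain ⟨φ, ψ, p, q, hφ, hψ, h⟩ := exists_apolarIdeal_eq_span_pair hσ hij hg h0
  have hlist : Ideal.span {φ, ψ} = Ideal.ofList [φ, ψ] := by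
    rw [Ideal.ofList_cons, Ideal.ofList_singleton, Ideal.span_insert]
  have hrel : IsRelPrime φ ψ := by
    intro x hxφ hxψ
    have key : ∀ l, x ∣ X l ^ (d + 1) := by
      intro l
      have : (X l ^ (d + 1) : MvPolynomial σ K) ∈ apolarIdeal g :=
        apolarAction_eq_zero_of_lt (isHomogeneous_X_pow l _) hg (Nat.lt_succ_self d)
      rw [h, Ideal.mem_span_pair] at this
      obtain ⟨a, b, hab⟩ := this
      rw [← hab]
      exact dvd_add (hxφ.mul_left a) (hxψ.mul_left b)
    have hXX : IsRelPrime (X i : MvPolynomial σ K) (X j) := by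
      rw [Irreducible.isRelPrime_iff_not_dvd X_prime.irreducible]
      rwa [X_dvd_X]
    exact (hXX.pow (m := d + 1) (n := d + 1)) (key i) (key j)
  have htop : Ideal.ofList [φ, ψ] ≠ ⊤ := by
    rw [← hlist, ← h]
    exact apolarIdeal_ne_top h0
  have hφ0 : φ ≠ 0 := by
    rintro rfl
    rw [isRelPrime_zero_left] at hrel
    exact htop (Ideal.eq_top_of_isUnit_mem _ (Ideal.subset_span (by simp)) hrel)
  refine ⟨[φ, ψ], ?_, isRegular_pair_of_isRelPrime hrel hφ0 htop, h.trans hlist⟩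
  intro r hr
  simp only [List.mem_cons, List.not_mem_nil, or_false] at hr
  rcases hr with rfl | rfl
  · exact ⟨p, hφ⟩
  · exact ⟨q, hψ⟩

/-- The apolar ideal of a nonzero form of degree `d` in one variable. -/
theorem apolarIdeal_eq_span_X_pow [CharZero K] {i : σ} (hσ : ∀ l, l = i)
    {g : MvPolynomial σ K} {d : ℕ} (hg : g.IsHomogeneous d) (h0 : g ≠ 0) :
    apolarIdeal g = Ideal.span {X i ^ (d + 1)} := by
  -- An annihilator has no constant term, so the only variable divides it, and the quotient
  -- annihilates the derivative. Each differentiation thus costs one factor `X i`.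
  have hX : ∀ {f Φ : MvPolynomial σ K} {e : ℕ}, f.IsHomogeneous e → f ≠ 0 →
      Φ ∈ apolarIdeal f → ∃ Θ, Φ = X i * Θ ∧ Θ ∈ apolarIdeal (pderiv i f) := by
    intro f Φ e hf hf0 hΦ
    obtain ⟨a, b, rfl⟩ := exists_eq_X_mul_add_X_mul (i := i) (j := i) (fun l => Or.inl (hσ l))
      (coeff_zero_eq_zero_of_mem_apolarIdeal hf hf0 hΦ)
    rw [← mul_add] at hΦ ⊢
    exact ⟨_, rfl, X_mul_mem_apolarIdeal.mp hΦ⟩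
  apply le_antisymm
  · intro Φ hΦ
    rw [Ideal.mem_span_singleton]
    induction d generalizing g Φ with
    | zero =>
      obtain ⟨Θ, rfl, -⟩ := hX hg h0 hΦ
      rw [zero_add, pow_one]
      exact dvd_mul_right _ _
    | succ d ih =>
      obtain ⟨Θ, rfl, hΘ⟩ := hX hg h0 hΦ
      rw [pow_succ']
      refine mul_dvd_mul_left _ (ih (hg.pderiv (i := i)) ?_ hΘ)
      intro hi
      have hC := eq_C_of_forall_pderiv_eq_zero (f := g) fun l => by rw [hσ l]; exact hi
      rw [hg.coeff_eq_zero (by rw [map_zero]; omega), C_0] at hC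
      exact h0 hC
  · rw [Ideal.span_singleton_le_iff_mem]
    exact apolarAction_eq_zero_of_lt (isHomogeneous_X_pow i _) hg (Nat.lt_succ_self d)

theorem isCompleteIntersection_of_unary [CharZero K] {i : σ} (hσ : ∀ l, l = i)
    {g : MvPolynomial σ K} {d : ℕ} (hg : g.IsHomogeneous d) (h0 : g ≠ 0) :
    IsCompleteIntersection (apolarIdeal g) := by
  have h := apolarIdeal_eq_span_X_pow hσ hg h0
  rw [← Ideal.ofList_singleton] at h
  refine ⟨[X i ^ (d + 1)], ?_, ⟨?_, ?_⟩, h⟩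
  · intro r hr
    rw [List.mem_singleton.mp hr]
    exact ⟨_, isHomogeneous_X_pow i _⟩
  · rw [RingTheory.Sequence.isWeaklyRegular_singleton_iff]
    exact IsSMulRegular.of_ne_zero (pow_ne_zero _ (X_ne_zero i))
  · rw [smul_eq_mul, Ideal.mul_top, ← h]
    exact (apolarIdeal_ne_top h0).symm

/-! ### Linear changes of coordinates. -/

theorem isHomogeneous_algHom {e : MvPolynomial σ K →ₐ[K] MvPolynomial τ K}
    (he : ∀ p, (e (X p)).IsHomogeneous 1) {h : MvPolynomial σ K} {d : ℕ}
    (hh : h.IsHomogeneous d) : (e h).IsHomogeneous d := by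
  have := hh.aeval (n := 1) (fun p => e (X p)) he
  rwa [one_mul, show aeval (fun p => e (X p)) = e from (aeval_unique e).symm] at this

theorem homogeneousComponent_algHom {e : MvPolynomial σ K →ₐ[K] MvPolynomial τ K}
    (he : ∀ p, (e (X p)).IsHomogeneous 1) (h : MvPolynomial σ K) (d : ℕ) :
    homogeneousComponent d (e h) = e (homogeneousComponent d h) := by
  conv_lhs => rw [← sum_homogeneousComponent h]
  rw [map_sum, map_sum, Finset.sum_eq_single d]
  · exact homogeneousComponent_eq_self
      (isHomogeneous_algHom he (homogeneousComponent_isHomogeneous d h))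
  · intro k _ hk
    rw [homogeneousComponent_of_mem
      (isHomogeneous_algHom he (homogeneousComponent_isHomogeneous k h)), if_neg hk.symm]
  · intro hd
    have : homogeneousComponent d h = 0 := homogeneousComponent_eq_zero _ _ (by simpa using hd)
    rw [this, map_zero, map_zero]

theorem isHomogeneous_of_algHom {e : MvPolynomial σ K →ₐ[K] MvPolynomial τ K}
    (he : ∀ p, (e (X p)).IsHomogeneous 1) (hinj : Function.Injective e)
    {h : MvPolynomial σ K} {d : ℕ} (hh : (e h).IsHomogeneous d) : h.IsHomogeneous d := by
  have : homogeneousComponent d h = h := by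
    apply hinj
    rw [← homogeneousComponent_algHom he, homogeneousComponent_eq_self hh]
  rw [← this]
  exact homogeneousComponent_isHomogeneous d h

theorem isHomogeneous_symm_X {e : MvPolynomial σ K ≃ₐ[K] MvPolynomial τ K}
    (he : ∀ p, (e (X p)).IsHomogeneous 1) (j : τ) : (e.symm (X j)).IsHomogeneous 1 := by
  refine isHomogeneous_of_algHom (e := e.toAlgHom) he e.injective ?_
  simpa using isHomogeneous_X K j

theorem pderiv_of_isHomogeneous_one {l : MvPolynomial σ K} (hl : l.IsHomogeneous 1) (i : σ) :
    pderiv i l = C (coeff (Finsupp.single i 1) l) := by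
  have h := hl.pderiv (i := i)
  rw [Nat.sub_self, ← totalDegree_zero_iff_isHomogeneous, totalDegree_eq_zero_iff_eq_C] at h
  rw [h, coeff_pderiv]
  simp

theorem eq_sum_of_isHomogeneous_one [Fintype σ] {l : MvPolynomial σ K}
    (hl : l.IsHomogeneous 1) : l = ∑ p, C (coeff (Finsupp.single p 1) l) * X p := by
  conv_lhs => rw [← one_smul ℕ l, ← hl.sum_X_mul_pderiv]
  exact Finset.sum_congr rfl fun p _ => by rw [pderiv_of_isHomogeneous_one hl, mul_comm]

section LinearChange

variable [Fintype σ]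

/-- The transpose of a linear substitution, acting on differential operators. -/
def transposeHom (e : MvPolynomial σ K →ₐ[K] MvPolynomial τ K) :
    MvPolynomial τ K →ₐ[K] MvPolynomial σ K :=
  aeval fun j => ∑ p, C (coeff (Finsupp.single j 1) (e (X p))) * X p

theorem transposeHom_X (e : MvPolynomial σ K →ₐ[K] MvPolynomial τ K) (j : τ) :
    transposeHom e (X j) = ∑ p, C (coeff (Finsupp.single j 1) (e (X p))) * X p :=
  aeval_X _ _

theorem isHomogeneous_transposeHom_X (e : MvPolynomial σ K →ₐ[K] MvPolynomial τ K) (j : τ) :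
    (transposeHom e (X j)).IsHomogeneous 1 := by
  rw [transposeHom_X]
  exact IsHomogeneous.sum _ _ _ fun p _ => (isHomogeneous_X K p).C_mul _

/-- The chain rule for linear substitutions. -/
theorem pderiv_algHom {e : MvPolynomial σ K →ₐ[K] MvPolynomial τ K}
    (he : ∀ p, (e (X p)).IsHomogeneous 1) (j : τ) (h : MvPolynomial σ K) :
    pderiv j (e h) = ∑ p, C (coeff (Finsupp.single j 1) (e (X p))) * e (pderiv p h) := by
  classical
  induction h using MvPolynomial.induction_on with
  | C a =>
    have : e (C a) = C a := e.commutes a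
    simp [this]
  | add p q hp hq => simp only [map_add, hp, hq, mul_add, Finset.sum_add_distrib]
  | mul_X h q ih =>
    rw [map_mul, pderiv_mul, ih, pderiv_of_isHomogeneous_one (he q)]
    simp only [pderiv_mul, map_add, map_mul, mul_add, Finset.sum_add_distrib, Finset.sum_mul,
      mul_assoc]
    congr 1
    rw [Finset.sum_eq_single q]
    · rw [pderiv_X_self, map_one, mul_one, mul_comm]
    · intro p _ hp
      rw [pderiv_X_of_ne hp.symm, map_zero, mul_zero, mul_zero]
    · intro hq
      exact absurd (Finset.mem_univ q) hq

/-- This iterates the chain rule. For invertible `e` it makes `Ann (e h)` the preimage of `Ann h`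
under the transpose. -/
theorem apolarAction_algHom {e : MvPolynomial σ K →ₐ[K] MvPolynomial τ K}
    (he : ∀ p, (e (X p)).IsHomogeneous 1) (Φ : MvPolynomial τ K) (h : MvPolynomial σ K) :
    apolarAction Φ (e h) = e (apolarAction (transposeHom e Φ) h) := by
  induction Φ using MvPolynomial.induction_on generalizing h with
  | C a =>
    have h1 : transposeHom e (C a) = C a := (transposeHom e).commutes a
    have h2 : e (C a) = C a := e.commutes a
    rw [h1, apolarAction_C_apply, apolarAction_C_apply, map_mul, h2]
  | add p q hp hq => simp only [map_add, LinearMap.add_apply, hp, hq]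
  | mul_X Φ j ih =>
    have h2 : ∀ a, e (C a) = C a := e.commutes
    rw [apolarAction_mul_apply, apolarAction_X, pderiv_algHom he, map_mul, apolarAction_mul_apply,
      transposeHom_X]
    have : ∑ p, C (coeff (Finsupp.single j 1) (e (X p))) * e (pderiv p h) =
        e (apolarAction (∑ p, C (coeff (Finsupp.single j 1) (e (X p))) * X p) h) := by
      rw [map_sum, LinearMap.sum_apply, map_sum]
      refine Finset.sum_congr rfl fun p _ => ?_
      rw [apolarAction_mul_apply, apolarAction_C_apply, apolarAction_X, map_mul, h2]
    rw [this, ih]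

/-- The transposes of inverse matrices are inverse to each other. The matrix identity is `key`, read
off from the coefficients of `e (e.symm (X l)) = X l`. -/
theorem transposeHom_symm_comp [Fintype τ] {e : MvPolynomial σ K ≃ₐ[K] MvPolynomial τ K}
    (he : ∀ p, (e (X p)).IsHomogeneous 1) :
    (transposeHom e.symm.toAlgHom).comp (transposeHom e.toAlgHom) = AlgHom.id K _ := by
  classical
  apply algHom_ext
  intro j
  have hC : ∀ a, transposeHom e.symm.toAlgHom (C a) = C a :=
    (transposeHom e.symm.toAlgHom).commutes
  rw [AlgHom.comp_apply, transposeHom_X, map_sum, AlgHom.id_apply]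
  simp only [map_mul, transposeHom_X, hC, Finset.mul_sum]
  rw [Finset.sum_comm]
  have key : ∀ l : τ, ∑ p, coeff (Finsupp.single j 1) (e (X p)) *
      coeff (Finsupp.single p 1) (e.symm (X l)) = if l = j then 1 else 0 := by
    intro l
    have h1 := congrArg e (eq_sum_of_isHomogeneous_one (isHomogeneous_symm_X he l))
    have h2 : ∀ a, e (C a) = C a := e.commutes
    rw [AlgEquiv.apply_symm_apply, map_sum] at h1
    have h3 := congrArg (coeff (Finsupp.single j 1)) h1
    simp only [map_mul, h2, coeff_sum, coeff_C_mul, coeff_X] at h3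
    simp only [Finsupp.single_left_inj one_ne_zero] at h3
    rw [h3]
    exact Finset.sum_congr rfl fun p _ => mul_comm _ _
  have : ∀ l : τ, ∑ p, C (coeff (Finsupp.single j 1) (e (X p))) *
      (C (coeff (Finsupp.single p 1) (e.symm (X l))) * X l) =
      if l = j then (X l : MvPolynomial τ K) else 0 := by
    intro l
    simp only [← mul_assoc, ← C_mul]
    rw [← Finset.sum_mul, ← map_sum, key]
    split_ifs <;> simp
  exact (Finset.sum_congr rfl fun l _ => this l).trans (by simp)

/-- The transpose of an invertible linear substitution. -/
def transposeEquiv [Fintype τ] (e : MvPolynomial σ K ≃ₐ[K] MvPolynomial τ K)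
    (he : ∀ p, (e (X p)).IsHomogeneous 1) : MvPolynomial τ K ≃ₐ[K] MvPolynomial σ K :=
  AlgEquiv.ofAlgHom (transposeHom e.toAlgHom) (transposeHom e.symm.toAlgHom)
    (transposeHom_symm_comp (e := e.symm) (isHomogeneous_symm_X he))
    (transposeHom_symm_comp he)

end LinearChange

theorem IsCompleteIntersection.map_algEquiv {I : Ideal (MvPolynomial σ K)}
    (hI : IsCompleteIntersection I) (e : MvPolynomial σ K ≃ₐ[K] MvPolynomial τ K)
    (he : ∀ p, (e (X p)).IsHomogeneous 1) :
    IsCompleteIntersection (I.map (e : MvPolynomial σ K →+* MvPolynomial τ K)) := by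
  obtain ⟨rs, hhom, hreg, rfl⟩ := hI
  refine ⟨rs.map e, ?_, ?_, ?_⟩
  · intro r hr
    obtain ⟨s, hs, rfl⟩ := List.mem_map.mp hr
    obtain ⟨d, hd⟩ := hhom s hs
    exact ⟨d, isHomogeneous_algHom (e := e.toAlgHom) he hd⟩
  · refine (AddEquiv.isRegular_congr (e := e.toRingEquiv.toAddEquiv) ?_).mp hreg
    refine List.forall₂_map_right_iff.mpr (List.forall₂_same.mpr fun r _ x => ?_)
    simp
  · rw [Ideal.map_ofList]
    rfl

theorem isCompleteIntersection_apolarIdeal_algEquiv [Finite σ] [Finite τ] {h : MvPolynomial σ K}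
    (hh : IsCompleteIntersection (apolarIdeal h)) (e : MvPolynomial σ K ≃ₐ[K] MvPolynomial τ K)
    (he : ∀ p, (e (X p)).IsHomogeneous 1) : IsCompleteIntersection (apolarIdeal (e h)) := by
  have := Fintype.ofFinite σ
  have := Fintype.ofFinite τ
  have h1 : apolarIdeal (e h) = (apolarIdeal h).map
      ((transposeEquiv e he).symm : MvPolynomial σ K →+* MvPolynomial τ K) := by
    ext Φ
    have h2 : Φ ∈ (apolarIdeal h).map
        ((transposeEquiv e he).symm : MvPolynomial σ K →+* MvPolynomial τ K) ↔
        transposeEquiv e he Φ ∈ apolarIdeal h := by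
      exact Ideal.mem_map_of_equiv (transposeEquiv e he).symm Φ |>.trans
        ⟨fun ⟨x, hx, hxe⟩ => by rw [← hxe]; simpa using hx, fun hx => ⟨_, hx, by simp⟩⟩
    rw [h2, mem_apolarIdeal, mem_apolarIdeal]
    have := apolarAction_algHom (e := e.toAlgHom) he Φ h
    have h3 : apolarAction Φ (e h) = e (apolarAction (transposeEquiv e he Φ) h) := this
    rw [h3, EmbeddingLike.map_eq_zero_iff]
  rw [h1]
  exact hh.map_algEquiv _ (isHomogeneous_transposeHom_X e.symm.toAlgHom)

/-! ### Factors of forms. -/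

section Factors

/-- The substitution `Xᵢ ↦ T Xᵢ` recording the degree in the variable `T`. -/
def degreeHom : MvPolynomial σ K →ₐ[K] Polynomial (MvPolynomial σ K) :=
  aeval fun i => Polynomial.C (X i) * Polynomial.X

theorem degreeHom_of_isHomogeneous {p : MvPolynomial σ K} {d : ℕ} (hp : p.IsHomogeneous d) :
    degreeHom p = Polynomial.C p * Polynomial.X ^ d := by
  have hmon : ∀ m : σ →₀ ℕ, ∀ a : K, m.degree = d → degreeHom (monomial m a) =
      Polynomial.C (monomial m a) * Polynomial.X ^ d := by
    intro m a hm
    rw [degreeHom, aeval_monomial, monomial_eq, map_mul, mul_assoc]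
    congr 1
    simp only [mul_pow]
    rw [Finsupp.prod_mul, Finsupp.prod, Finsupp.prod, Finsupp.prod, map_prod,
      Finset.prod_pow_eq_pow_sum, ← hm]
    simp only [map_pow]
    rfl
  conv_lhs => rw [p.as_sum]
  conv_rhs => rw [p.as_sum]
  rw [map_sum, map_sum, Finset.sum_mul]
  exact Finset.sum_congr rfl fun m hm =>
    hmon m _ (degree_eq_of_coeff_ne_zero hp (mem_support_iff.mp hm))

theorem coeff_degreeHom (p : MvPolynomial σ K) (d : ℕ) :
    (degreeHom p).coeff d = homogeneousComponent d p := by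
  conv_lhs => rw [← sum_homogeneousComponent p]
  rw [map_sum, Polynomial.finsetSum_coeff]
  simp only [degreeHom_of_isHomogeneous (homogeneousComponent_isHomogeneous _ p),
    Polynomial.coeff_C_mul, Polynomial.coeff_X_pow]
  rw [Finset.sum_eq_single d]
  · simp
  · intro k _ hk
    rw [if_neg hk.symm, mul_zero]
  · intro hd
    have : homogeneousComponent d p = 0 := homogeneousComponent_eq_zero _ _ (by simpa using hd)
    rw [this, zero_mul]

/-- A factor of a nonzero form is a form. -/
theorem exists_isHomogeneous_of_mul {p q : MvPolynomial σ K} {d : ℕ}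
    (h : (p * q).IsHomogeneous d) (h0 : p * q ≠ 0) : ∃ k, p.IsHomogeneous k := by
  have hpq : degreeHom p * degreeHom q = Polynomial.C (p * q) * Polynomial.X ^ d := by
    rw [← map_mul, degreeHom_of_isHomogeneous h]
  have hne : Polynomial.C (p * q) * (Polynomial.X : Polynomial (MvPolynomial σ K)) ^ d ≠ 0 :=
    mul_ne_zero (Polynomial.C_ne_zero.mpr h0) (pow_ne_zero _ Polynomial.X_ne_zero)
  have hP : degreeHom p ≠ 0 := left_ne_zero_of_mul (hpq ▸ hne)
  have hQ : degreeHom q ≠ 0 := right_ne_zero_of_mul (hpq ▸ hne)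
  -- Highest and lowest degree in `T` are both additive over a domain, and both equal `d` for the
  -- product. Hence they agree for each factor.
  have h1 := Polynomial.natDegree_mul hP hQ
  have h2 := Polynomial.natTrailingDegree_mul hP hQ
  rw [hpq, Polynomial.natDegree_C_mul_X_pow _ _ h0] at h1
  rw [hpq, Polynomial.C_mul_X_pow_eq_monomial, Polynomial.natTrailingDegree_monomial h0] at h2
  have h3 := (degreeHom p).natTrailingDegree_le_natDegree
  have h4 := (degreeHom q).natTrailingDegree_le_natDegree
  have key : ∀ k, homogeneousComponent k p ≠ 0 → k = (degreeHom p).natDegree := by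
    intro k hk
    rw [← coeff_degreeHom] at hk
    have := Polynomial.le_natDegree_of_ne_zero hk
    have := Polynomial.natTrailingDegree_le_of_ne_zero hk
    omega
  refine ⟨(degreeHom p).natDegree, ?_⟩
  rw [← sum_homogeneousComponent p]
  refine IsHomogeneous.sum _ _ _ fun k _ => ?_
  by_cases hk : homogeneousComponent k p = 0
  · rw [hk]
    exact isHomogeneous_zero _ _ _
  · rw [sum_homogeneousComponent p, ← key k hk]
    exact homogeneousComponent_isHomogeneous k p

end Factors

/-! ### Products of polynomials in disjoint sets of variables. -/

theorem tensorEquivSum_tmul (p : MvPolynomial σ K) (q : MvPolynomial τ K) :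
    tensorEquivSum K σ τ K (p ⊗ₜ q) = rename Sum.inl p * rename Sum.inr q := by
  have h1 : ((tensorEquivSum K σ τ K).toAlgHom.comp Algebra.TensorProduct.includeLeft) =
      rename Sum.inl := by
    apply algHom_ext
    intro i
    simp
  have h2 : (((tensorEquivSum K σ τ K).toAlgHom.restrictScalars K).comp
      Algebra.TensorProduct.includeRight) = rename Sum.inr := by
    apply algHom_ext
    intro i
    simp
  have h : p ⊗ₜ[K] q = p ⊗ₜ[K] (1 : MvPolynomial τ K) * (1 : MvPolynomial σ K) ⊗ₜ[K] q := by
    rw [Algebra.TensorProduct.tmul_mul_tmul, mul_one, one_mul]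
  rw [h, map_mul, ← h1, ← h2]
  rfl

theorem pderiv_inl_rename_inr (i : σ) (g : MvPolynomial τ K) :
    pderiv (Sum.inl i) (rename Sum.inr g : MvPolynomial (σ ⊕ τ) K) = 0 := by
  classical
  refine pderiv_eq_zero_of_notMem_vars fun h => ?_
  simpa using Finset.mem_of_subset (vars_rename _ _) h

theorem pderiv_inr_rename_inl (i : τ) (f : MvPolynomial σ K) :
    pderiv (Sum.inr i) (rename Sum.inl f : MvPolynomial (σ ⊕ τ) K) = 0 := by
  classical
  refine pderiv_eq_zero_of_notMem_vars fun h => ?_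
  simpa using Finset.mem_of_subset (vars_rename _ _) h

theorem apolarAction_rename_inl (Φ f : MvPolynomial σ K) (g : MvPolynomial τ K) :
    apolarAction (rename Sum.inl Φ) (rename Sum.inl f * rename Sum.inr g) =
      rename Sum.inl (apolarAction Φ f) * rename Sum.inr g := by
  induction Φ using MvPolynomial.induction_on generalizing f with
  | C a => rw [rename_C, apolarAction_C_apply, apolarAction_C_apply, map_mul, rename_C, mul_assoc]
  | add p q hp hq => simp only [map_add, LinearMap.add_apply, hp, hq, add_mul]
  | mul_X Φ i ih =>
    rw [map_mul (rename _) Φ, rename_X, apolarAction_mul_apply, apolarAction_mul_apply,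
      apolarAction_X, apolarAction_X, pderiv_mul, pderiv_inl_rename_inr, mul_zero, add_zero,
      pderiv_rename Sum.inl_injective, ih]

theorem apolarAction_rename_inr (Φ g : MvPolynomial τ K) (f : MvPolynomial σ K) :
    apolarAction (rename Sum.inr Φ) (rename Sum.inl f * rename Sum.inr g) =
      rename Sum.inl f * rename Sum.inr (apolarAction Φ g) := by
  induction Φ using MvPolynomial.induction_on generalizing g with
  | C a =>
    rw [rename_C, apolarAction_C_apply, apolarAction_C_apply, map_mul, rename_C, mul_left_comm]
  | add p q hp hq => simp only [map_add, LinearMap.add_apply, hp, hq, mul_add]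
  | mul_X Φ i ih =>
    rw [map_mul (rename _) Φ, rename_X, apolarAction_mul_apply, apolarAction_mul_apply,
      apolarAction_X, apolarAction_X, pderiv_mul, pderiv_inr_rename_inl, zero_mul, zero_add,
      pderiv_rename Sum.inr_injective, ih]

/-- Over a field the injection of `V / ker u` into `W` splits. This lets the quotient map by an
apolar ideal factor through the evaluation `Φ ↦ Φ ∘ f` on the whole polynomial ring. -/
theorem exists_comp_eq_of_ker_le {V W U : Type*} [AddCommGroup V] [Module K V] [AddCommGroup W]
    [Module K W] [AddCommGroup U] [Module K U] (u : V →ₗ[K] W) (v : V →ₗ[K] U)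
    (h : LinearMap.ker u ≤ LinearMap.ker v) : ∃ w : W →ₗ[K] U, w ∘ₗ u = v := by
  obtain ⟨s, hs⟩ := LinearMap.exists_leftInverse_of_injective
    ((LinearMap.ker u).liftQ u le_rfl) (Submodule.ker_liftQ_eq_bot _ _ _ le_rfl)
  refine ⟨(LinearMap.ker u).liftQ v h ∘ₗ s, LinearMap.ext fun x => ?_⟩
  have := LinearMap.congr_fun hs ((LinearMap.ker u).mkQ x)
  simp only [LinearMap.comp_apply, Submodule.mkQ_apply, Submodule.liftQ_apply,
    LinearMap.id_apply] at this ⊢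
  rw [this, Submodule.liftQ_apply]

/-- The evaluation `Φ ↦ Φ ∘ f`. -/
def apolarEval (f : MvPolynomial σ K) : MvPolynomial σ K →ₗ[K] MvPolynomial σ K :=
  LinearMap.applyₗ f ∘ₗ (apolarAction (K := K) (σ := σ)).toLinearMap

theorem ker_mkAlgHom (I : Ideal (MvPolynomial σ K)) :
    RingHom.ker (Ideal.Quotient.mkₐ K I) = I :=
  Ideal.ext fun _ => Ideal.Quotient.eq_zero_iff_mem

/-- The quotient map onto the tensor product of two quotients of polynomial rings. -/
abbrev quotientTensorHom (I : Ideal (MvPolynomial σ K)) (J : Ideal (MvPolynomial τ K)) :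
    MvPolynomial σ K ⊗[K] MvPolynomial τ K →ₐ[K]
      (MvPolynomial σ K ⧸ I) ⊗[K] (MvPolynomial τ K ⧸ J) :=
  Algebra.TensorProduct.map (Ideal.Quotient.mkₐ K I) (Ideal.Quotient.mkₐ K J)

/-- The kernel of a tensor product of two surjections is generated by the two kernels. -/
theorem mem_map_sup_map_of_quotientTensorHom_eq_zero {I : Ideal (MvPolynomial σ K)}
    {J : Ideal (MvPolynomial τ K)} {x : MvPolynomial σ K ⊗[K] MvPolynomial τ K}
    (hx : quotientTensorHom I J x = 0) :
    tensorEquivSum K σ τ K x ∈ I.map (rename Sum.inl : MvPolynomial σ K →ₐ[K] _) ⊔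
      J.map (rename Sum.inr : MvPolynomial τ K →ₐ[K] MvPolynomial (σ ⊕ τ) K) := by
  have h : x ∈ RingHom.ker (quotientTensorHom I J) := hx
  rw [Algebra.TensorProduct.map_ker _ _ (Ideal.Quotient.mkₐ_surjective K I)
    (Ideal.Quotient.mkₐ_surjective K J), ker_mkAlgHom, ker_mkAlgHom] at h
  have h' := Ideal.mem_map_of_mem (tensorEquivSum K σ τ K) h
  rw [Ideal.map_sup] at h'
  refine SetLike.le_def.mp (sup_le_sup ?_ ?_) h'
  · rw [Ideal.map_le_iff_le_comap, Ideal.map_le_iff_le_comap]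
    intro p hp
    simp only [Ideal.mem_comap, Algebra.TensorProduct.includeLeft_apply, tensorEquivSum_tmul,
      map_one, mul_one]
    exact Ideal.mem_map_of_mem _ hp
  · rw [Ideal.map_le_iff_le_comap, Ideal.map_le_iff_le_comap]
    intro p hp
    simp only [Ideal.mem_comap, Algebra.TensorProduct.includeRight_apply, tensorEquivSum_tmul,
      map_one, one_mul]
    exact Ideal.mem_map_of_mem _ hp

/-- The apolar ideal of a product of polynomials in disjoint sets of variables. -/
theorem apolarIdeal_rename_mul_rename (f : MvPolynomial σ K) (g : MvPolynomial τ K) :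
    apolarIdeal (rename Sum.inl f * rename Sum.inr g : MvPolynomial (σ ⊕ τ) K) =
      (apolarIdeal f).map (rename Sum.inl : MvPolynomial σ K →ₐ[K] _) ⊔
      (apolarIdeal g).map (rename Sum.inr : MvPolynomial τ K →ₐ[K] _) := by
  apply le_antisymm
  · intro Φ hΦ
    obtain ⟨x, rfl⟩ := (tensorEquivSum K σ τ K).surjective Φ
    apply mem_map_sup_map_of_quotientTensorHom_eq_zero
    have key : ∀ y, apolarAction (tensorEquivSum K σ τ K y)
        (rename Sum.inl f * rename Sum.inr g) =
        tensorEquivSum K σ τ K (TensorProduct.map (apolarEval f) (apolarEval g) y) := by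
      intro y
      induction y with
      | zero => simp
      | add a b ha hb => simp only [map_add, LinearMap.add_apply, ha, hb]
      | tmul p q =>
        rw [TensorProduct.map_tmul, tensorEquivSum_tmul, tensorEquivSum_tmul,
          apolarAction_mul_apply, apolarAction_rename_inr, apolarAction_rename_inl]
        rfl
    rw [mem_apolarIdeal, key, EmbeddingLike.map_eq_zero_iff] at hΦ
    -- Since `Ann f` and `Ann g` are the kernels of the evaluations, what the tensor product of the
    -- evaluations kills is also killed in the tensor product of the quotients.
    obtain ⟨w₁, hw₁⟩ := exists_comp_eq_of_ker_le (apolarEval f)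
      (Ideal.Quotient.mkₐ K (apolarIdeal f)).toLinearMap fun p hp =>
        Ideal.Quotient.eq_zero_iff_mem.mpr hp
    obtain ⟨w₂, hw₂⟩ := exists_comp_eq_of_ker_le (apolarEval g)
      (Ideal.Quotient.mkₐ K (apolarIdeal g)).toLinearMap fun p hp =>
        Ideal.Quotient.eq_zero_iff_mem.mpr hp
    have h : quotientTensorHom (apolarIdeal f) (apolarIdeal g) x =
        TensorProduct.map w₁ w₂ (TensorProduct.map (apolarEval f) (apolarEval g) x) := by
      rw [← LinearMap.comp_apply, ← TensorProduct.map_comp, hw₁, hw₂]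
      rfl
    rw [h, hΦ, map_zero]
  · refine sup_le ?_ ?_
    · rw [Ideal.map_le_iff_le_comap]
      intro Φ hΦ
      rw [Ideal.mem_comap, mem_apolarIdeal, apolarAction_rename_inl, mem_apolarIdeal.mp hΦ,
        map_zero, zero_mul]
    · rw [Ideal.map_le_iff_le_comap]
      intro Φ hΦ
      rw [Ideal.mem_comap, mem_apolarIdeal, apolarAction_rename_inr, mem_apolarIdeal.mp hΦ,
        map_zero, mul_zero]

/-- Concatenating weakly regular sequences in disjoint sets of variables. -/
theorem isWeaklyRegular_tmul_append {rs : List (MvPolynomial σ K)}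
    {ss : List (MvPolynomial τ K)}
    (hr : RingTheory.Sequence.IsWeaklyRegular (MvPolynomial σ K) rs)
    (hs : RingTheory.Sequence.IsWeaklyRegular (MvPolynomial τ K) ss) :
    RingTheory.Sequence.IsWeaklyRegular (MvPolynomial σ K ⊗[K] MvPolynomial τ K)
      (ss.map (fun q => (1 : MvPolynomial σ K) ⊗ₜ[K] q) ++
        rs.map (fun p => p ⊗ₜ[K] (1 : MvPolynomial τ K))) := by
  rw [RingTheory.Sequence.isWeaklyRegular_append_iff]
  constructor
  -- The tensor product is flat over either factor, so `ss` stays weakly regular.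
  · have h1 := hs.of_flat (S := MvPolynomial τ K ⊗[K] MvPolynomial σ K)
    refine (AddEquiv.isWeaklyRegular_congr
      (e := (Algebra.TensorProduct.comm K (MvPolynomial τ K)
        (MvPolynomial σ K)).toRingEquiv.toAddEquiv) ?_).mp h1
    refine List.forall₂_map_right_iff.mpr (List.forall₂_map_left_iff.mpr
      (List.forall₂_same.mpr fun r _ x => ?_))
    change Algebra.TensorProduct.comm K (MvPolynomial τ K) (MvPolynomial σ K)
      (r ⊗ₜ[K] 1 * x) = _ * Algebra.TensorProduct.comm K _ _ x
    rw [map_mul, Algebra.TensorProduct.comm_tmul]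
  · set J := Ideal.ofList ss
    -- Modulo `ss` the ring becomes this tensor product, which is still flat over the ring
    -- containing `rs`.
    have h1 := hr.of_flat (S := MvPolynomial σ K ⊗[K] (MvPolynomial τ K ⧸ J))
    let π : MvPolynomial σ K ⊗[K] MvPolynomial τ K →ₐ[K]
        MvPolynomial σ K ⊗[K] (MvPolynomial τ K ⧸ J) :=
      Algebra.TensorProduct.map (AlgHom.id K _) (Ideal.Quotient.mkₐ K J)
    have hπ : Function.Surjective π := Algebra.TensorProduct.map_surjective _ _
      Function.surjective_id (Ideal.Quotient.mkₐ_surjective K J)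
    have hker : RingHom.ker π =
        (Ideal.ofList (ss.map fun q => (1 : MvPolynomial σ K) ⊗ₜ[K] q) •
          (⊤ : Submodule (MvPolynomial σ K ⊗[K] MvPolynomial τ K)
            (MvPolynomial σ K ⊗[K] MvPolynomial τ K))) := by
      rw [Algebra.TensorProduct.lTensor_ker _ (Ideal.Quotient.mkₐ_surjective K J),
        ker_mkAlgHom, smul_eq_mul, Ideal.mul_top]
      exact Ideal.map_ofList (Algebra.TensorProduct.includeRight : MvPolynomial τ K →ₐ[K]
        MvPolynomial σ K ⊗[K] MvPolynomial τ K).toRingHom ss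
    let E := (Submodule.quotEquivOfEq _ _ hker.symm).toAddEquiv.trans
      (RingHom.quotientKerEquivOfSurjective (f := π.toRingHom) hπ).toAddEquiv
    refine (AddEquiv.isWeaklyRegular_congr (e := E) ?_).mpr h1
    refine List.forall₂_map_right_iff.mpr (List.forall₂_map_left_iff.mpr
      (List.forall₂_same.mpr fun r _ x => ?_))
    obtain ⟨x, rfl⟩ := Submodule.Quotient.mk_surjective _ x
    change π (_ * x) = _ * π x
    rw [map_mul]
    rfl

theorem isWeaklyRegular_rename_append {rs : List (MvPolynomial σ K)}
    {ss : List (MvPolynomial τ K)}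
    (hr : RingTheory.Sequence.IsWeaklyRegular (MvPolynomial σ K) rs)
    (hs : RingTheory.Sequence.IsWeaklyRegular (MvPolynomial τ K) ss) :
    RingTheory.Sequence.IsWeaklyRegular (MvPolynomial (σ ⊕ τ) K)
      (ss.map (rename Sum.inr) ++ rs.map (rename Sum.inl)) := by
  refine (AddEquiv.isWeaklyRegular_congr
    (e := (tensorEquivSum K σ τ K).toRingEquiv.toAddEquiv) ?_).mp
    (isWeaklyRegular_tmul_append hr hs)
  refine List.rel_append ?_ ?_
  all_goals
    refine List.forall₂_map_right_iff.mpr (List.forall₂_map_left_iff.mpr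
      (List.forall₂_same.mpr fun r _ x => ?_))
    change tensorEquivSum K σ τ K (_ * x) = _ * tensorEquivSum K σ τ K x
    rw [map_mul, tensorEquivSum_tmul]
    simp only [map_one, one_mul, mul_one]

theorem isCompleteIntersection_apolarIdeal_rename_mul_rename
    {f : MvPolynomial σ K} {g : MvPolynomial τ K} (hf0 : f ≠ 0) (hg0 : g ≠ 0)
    (hf : IsCompleteIntersection (apolarIdeal f)) (hg : IsCompleteIntersection (apolarIdeal g)) :
    IsCompleteIntersection (apolarIdeal
      (rename Sum.inl f * rename Sum.inr g : MvPolynomial (σ ⊕ τ) K)) := by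
  -- Weak regularity of the joint sequence does not give properness, which comes instead from the
  -- product being nonzero.
  have htop := apolarIdeal_ne_top (mul_ne_zero
    ((map_ne_zero_iff _ (rename_injective (R := K) _ (Sum.inl_injective (β := τ)))).mpr hf0)
    ((map_ne_zero_iff _ (rename_injective (R := K) _ (Sum.inr_injective (α := σ)))).mpr hg0))
  obtain ⟨rs, hrs, hr, hI⟩ := hf
  obtain ⟨ss, hss, hs, hJ⟩ := hg
  have h : apolarIdeal (rename Sum.inl f * rename Sum.inr g : MvPolynomial (σ ⊕ τ) K) =
      Ideal.ofList (ss.map (rename Sum.inr) ++ rs.map (rename Sum.inl)) := by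
    rw [apolarIdeal_rename_mul_rename, hI, hJ, Ideal.ofList_append, sup_comm]
    exact congrArg₂ _
      (Ideal.map_ofList (rename Sum.inr : MvPolynomial τ K →ₐ[K] _).toRingHom ss)
      (Ideal.map_ofList (rename Sum.inl : MvPolynomial σ K →ₐ[K] _).toRingHom rs)
  refine ⟨_, ?_, ⟨isWeaklyRegular_rename_append hr.toIsWeaklyRegular hs.toIsWeaklyRegular, ?_⟩, h⟩
  · intro r hr
    rw [List.mem_append, List.mem_map, List.mem_map] at hr
    rcases hr with ⟨s, hs, rfl⟩ | ⟨s, hs, rfl⟩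
    · obtain ⟨d, hd⟩ := hss s hs
      exact ⟨d, hd.rename_isHomogeneous⟩
    · obtain ⟨d, hd⟩ := hrs s hs
      exact ⟨d, hd.rename_isHomogeneous⟩
  · rw [smul_eq_mul, Ideal.mul_top, ← h]
    exact htop.symm

/-! ### Several blocks of variables. -/

theorem apolarIdeal_one_of_isEmpty [IsEmpty σ] :
    apolarIdeal (1 : MvPolynomial σ K) = ⊥ := by
  rw [eq_bot_iff]
  intro Φ hΦ
  rw [eq_C_of_isEmpty Φ, mem_apolarIdeal, apolarAction_C_apply, mul_one] at hΦ
  rw [eq_C_of_isEmpty Φ, hΦ]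
  exact Ideal.zero_mem _

/-- Splitting off the first block of variables. -/
def sumSigmaSuccEquiv {k : ℕ} (α : Fin (k + 1) → Type*) :
    (α 0 ⊕ Σ i : Fin k, α i.succ) ≃ Σ i, α i :=
  Equiv.ofBijective (Sum.elim (Sigma.mk 0) fun p => ⟨p.1.succ, p.2⟩) <| by
    constructor
    · rintro (a | ⟨i, a⟩) (b | ⟨j, b⟩) h
      · simpa using h
      · exact absurd (congrArg Sigma.fst h) (Fin.succ_ne_zero j).symm
      · exact absurd (congrArg Sigma.fst h) (Fin.succ_ne_zero i)
      · obtain rfl : i = j := Fin.succ_injective _ (congrArg Sigma.fst h)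
        simpa using h
    · rintro ⟨i, a⟩
      induction i using Fin.cases with
      | zero => exact ⟨Sum.inl a, rfl⟩
      | succ i => exact ⟨Sum.inr ⟨i, a⟩, rfl⟩

theorem isCompleteIntersection_apolarIdeal_prod {k : ℕ} (α : Fin k → Type*)
    [∀ i, Finite (α i)] (g : ∀ i, MvPolynomial (α i) K) (h0 : ∀ i, g i ≠ 0)
    (h : ∀ i, IsCompleteIntersection (apolarIdeal (g i))) :
    IsCompleteIntersection (apolarIdeal
      (∏ i, rename (Sigma.mk i) (g i) : MvPolynomial (Σ i, α i) K)) := by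
  induction k with
  | zero =>
    rw [Finset.univ_eq_empty, Finset.prod_empty]
    -- With no blocks the ring is `K`, the form is `1`, and the empty sequence generates the zero
    -- annihilator.
    exact ⟨[], by simp, RingTheory.Sequence.IsRegular.nil _ _,
      by rw [apolarIdeal_one_of_isEmpty, Ideal.ofList_nil]⟩
  | succ k ih =>
    have h1 := ih (fun i => α i.succ) (fun i => g i.succ) (fun i => h0 _) (fun i => h _)
    have hne : (∏ i : Fin k, rename (Sigma.mk i) (g i.succ) :
        MvPolynomial (Σ i : Fin k, α i.succ) K) ≠ 0 :=
      Finset.prod_ne_zero_iff.mpr fun i _ =>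
        (map_ne_zero_iff _ (rename_injective _ sigma_mk_injective)).mpr (h0 _)
    have h2 := isCompleteIntersection_apolarIdeal_algEquiv
      (isCompleteIntersection_apolarIdeal_rename_mul_rename (h0 0) hne (h 0) h1)
      (renameEquiv K (sumSigmaSuccEquiv α))
      (fun p => by rw [renameEquiv_apply, rename_X]; exact isHomogeneous_X K _)
    convert h2 using 2
    rw [Fin.prod_univ_succ, renameEquiv_apply, map_mul, rename_rename, rename_rename, map_prod]
    congr 1
    exact Finset.prod_congr rfl fun i _ => by rw [rename_rename]; rfl

theorem isCompleteIntersection_of_fin [CharZero K] {n : ℕ} (hn : n = 1 ∨ n = 2)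
    {g : MvPolynomial (Fin n) K} {d : ℕ} (hg : g.IsHomogeneous d) (h0 : g ≠ 0) :
    IsCompleteIntersection (apolarIdeal g) := by
  rcases hn with rfl | rfl
  · exact isCompleteIntersection_of_unary (i := 0) (fun l => Subsingleton.elim _ _) hg h0
  · exact isCompleteIntersection_of_binary (i := 0) (j := 1)
      (fun l => by fin_cases l <;> simp) (by simp) hg h0

/-- A form that is a product of forms in disjoint sets of at most two variables has a complete
intersection apolar ideal. -/
theorem isCompleteIntersection_of_eq_prod [CharZero K] {k : ℕ} {m : Fin k → ℕ}
    (hm : ∀ i, m i = 1 ∨ m i = 2) [Finite τ]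
    (e : MvPolynomial (Σ i : Fin k, Fin (m i)) K ≃ₐ[K] MvPolynomial τ K)
    (he : ∀ p, (e (X p)).IsHomogeneous 1) (g : ∀ i : Fin k, MvPolynomial (Fin (m i)) K)
    {f : MvPolynomial τ K} {d : ℕ} (hf : f.IsHomogeneous d) (h0 : f ≠ 0)
    (h : f = ∏ i, e (rename (Sigma.mk i) (g i))) :
    IsCompleteIntersection (apolarIdeal f) := by
  classical
  rw [← map_prod] at h
  subst h
  have hP := isHomogeneous_of_algHom (e := e.toAlgHom) he e.injective hf
  rw [Ne, EmbeddingLike.map_eq_zero_iff] at h0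
  have hi : ∀ i, g i ≠ 0 := fun i hi =>
    h0 (Finset.prod_eq_zero (Finset.mem_univ i) (by rw [hi, map_zero]))
  refine isCompleteIntersection_apolarIdeal_algEquiv
    (isCompleteIntersection_apolarIdeal_prod _ g hi fun i => ?_) e he
  -- Homogeneity of the factors is not assumed; each is a form because it divides a nonzero form.
  rw [← Finset.mul_prod_erase _ _ (Finset.mem_univ i)] at hP h0
  obtain ⟨l, hl⟩ := exists_isHomogeneous_of_mul hP h0
  have hinj : Function.Injective (Sigma.mk (β := fun j => Fin (m j)) i) := sigma_mk_injective
  exact isCompleteIntersection_of_fin (hm i)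
    ((IsHomogeneous.rename_isHomogeneous_iff hinj).mp hl) (hi i)

/-! ### Linear maps as substitutions, and linear forms supported on one block. -/

section LinearSubstitution

/-- The substitution of a linear map into a polynomial. -/
def linearSubst [Fintype τ] [DecidableEq τ] (M : (τ → K) →ₗ[K] (σ → K)) :
    MvPolynomial σ K →ₐ[K] MvPolynomial τ K :=
  aeval fun p => ∑ j, C (M (Pi.single j 1) p) * X j

theorem isHomogeneous_linearSubst_X [Fintype τ] [DecidableEq τ] (M : (τ → K) →ₗ[K] (σ → K))
    (p : σ) : (linearSubst M (X p)).IsHomogeneous 1 := by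
  rw [linearSubst, aeval_X]
  exact IsHomogeneous.sum _ _ _ fun j _ => (isHomogeneous_X K j).C_mul _

theorem eval_linearSubst [Fintype τ] [DecidableEq τ] (M : (τ → K) →ₗ[K] (σ → K)) (v : τ → K)
    (h : MvPolynomial σ K) : eval v (linearSubst M h) = eval (M v) h := by
  induction h using MvPolynomial.induction_on with
  | C a => simp [linearSubst]
  | add p q hp hq => simp only [map_add, hp, hq]
  | mul_X h p ih =>
    rw [map_mul, map_mul, map_mul, ih, eval_X, linearSubst, aeval_X]
    congr 1
    have hv : v = ∑ j, v j • Pi.single (M := fun _ => K) j 1 := by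
      rw [← LinearMap.sum_single_apply (fun _ => K) v]
      refine Finset.sum_congr rfl fun j _ => ?_
      rw [← Pi.single_smul, smul_eq_mul, mul_one]
      simp
    conv_rhs => rw [hv]
    simp [mul_comm]

/-- The substitution of a linear isomorphism into a polynomial. -/
def linearSubstEquiv [Infinite K] [Fintype σ] [DecidableEq σ] [Fintype τ] [DecidableEq τ]
    (L : (τ → K) ≃ₗ[K] (σ → K)) : MvPolynomial σ K ≃ₐ[K] MvPolynomial τ K :=
  AlgEquiv.ofAlgHom (linearSubst L.toLinearMap) (linearSubst L.symm.toLinearMap)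
    -- Over an infinite field polynomials are determined by their values, so inverse maps on points
    -- give inverse substitutions.
    (AlgHom.ext fun h => MvPolynomial.funext fun v => by
      simp [eval_linearSubst])
    (AlgHom.ext fun h => MvPolynomial.funext fun v => by
      simp [eval_linearSubst])

theorem eval_linearSubstEquiv_symm [Infinite K] [Fintype σ] [DecidableEq σ] [Fintype τ]
    [DecidableEq τ] (L : (τ → K) ≃ₗ[K] (σ → K)) (w : σ → K) (l : MvPolynomial τ K) :
    eval w ((linearSubstEquiv L).symm l) = eval (L.symm w) l :=
  eval_linearSubst _ w l

theorem eval_single_of_isHomogeneous_one [Fintype σ] [DecidableEq σ] {l : MvPolynomial σ K}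
    (hl : l.IsHomogeneous 1) (p : σ) :
    eval (Pi.single p 1) l = coeff (Finsupp.single p 1) l := by
  conv_lhs => rw [eq_sum_of_isHomogeneous_one hl]
  rw [map_sum, Finset.sum_eq_single p]
  · simp
  · intro q _ hq
    simp [hq]
  · intro h
    exact absurd (Finset.mem_univ p) h

/-- A linear form on a product that vanishes on vectors with zero `i`-th component is a linear
form in the variables of the `i`-th block. -/
theorem exists_rename_eq_of_isHomogeneous_one {k : ℕ} {m : Fin k → ℕ} (i : Fin k)
    {l : MvPolynomial (Σ i : Fin k, Fin (m i)) K} (hl : l.IsHomogeneous 1)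
    (h : ∀ w : (Σ i : Fin k, Fin (m i)) → K, (∀ p, w ⟨i, p⟩ = 0) → eval w l = 0) :
    ∃ b : MvPolynomial (Fin (m i)) K, l = rename (Sigma.mk i) b := by
  refine ⟨∑ p, C (coeff (Finsupp.single ⟨i, p⟩ 1) l) * X p, ?_⟩
  conv_lhs => rw [eq_sum_of_isHomogeneous_one hl]
  rw [Fintype.sum_sigma, Finset.sum_eq_single i]
  · simp
  · intro j _ hj
    refine Finset.sum_eq_zero fun q _ => ?_
    -- The coefficient is the value at a unit vector of block `j`, whose component in block `i` is
    -- zero.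
    rw [← eval_single_of_isHomogeneous_one hl, h, C_0, zero_mul]
    intro p
    refine Pi.single_eq_of_ne (fun hpq => hj ?_) _
    exact (congrArg Sigma.fst hpq).symm
  · intro hi
    exact absurd (Finset.mem_univ i) hi

end LinearSubstitution

/-! ### Defining polynomials of products of multi-arrangements. -/

namespace MultiArrangement

theorem IsDefiningPolynomial.ne_zero {A : MultiArrangement K (σ → K)} {f : MvPolynomial σ K}
    (h : A.IsDefiningPolynomial f) : f ≠ 0 := by
  obtain ⟨α, hα, rfl⟩ := h
  -- A zero form would vanish everywhere, whereas a hyperplane is proper.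
  refine Finset.prod_ne_zero_iff.mpr fun H hH => pow_ne_zero _ fun h0 => ?_
  refine (A.isHyperplane H hH).1 (eq_top_iff.mpr fun v _ => ?_)
  rw [← (hα H hH).2, h0, map_zero]

theorem IsDefiningPolynomial.exists_isHomogeneous {A : MultiArrangement K (σ → K)}
    {f : MvPolynomial σ K} (h : A.IsDefiningPolynomial f) : ∃ d, f.IsHomogeneous d := by
  obtain ⟨α, hα, rfl⟩ := h
  exact ⟨_, IsHomogeneous.prod _ _ _ fun H hH => ((hα H hH).1).pow _⟩

variable {V : Type*} [AddCommGroup V] [Module K V] {k : ℕ} {U : Fin k → Type*}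
  [∀ i, AddCommGroup (U i)] [∀ i, Module K (U i)]

/-- Inverse images under surjections are injective on subspaces, and natural multiplicities cannot
cancel in the sum. So the chosen linear form is controlled at every hyperplane coming from a factor.
-/
theorem mem_support_comap_pi (B : ∀ i, MultiArrangement K (U i)) (g : V →ₗ[K] ∀ i, U i)
    (hg : Function.Surjective g) {i : Fin k} {G : Submodule K (U i)}
    (hG : G ∈ (B i).mult.support) :
    (G.comap (LinearMap.proj i)).comap g ∈ ((pi B).comap g hg).mult.support := by
  rw [Finsupp.mem_support_iff] at hG ⊢
  change (pi B).mult.mapDomain (Submodule.comap g) _ ≠ 0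
  rw [Finsupp.mapDomain_apply (Submodule.comap_injective_of_surjective hg)]
  change (∑ i, (B i).mult.mapDomain (Submodule.comap (LinearMap.proj i)) :
    Submodule K (∀ i, U i) →₀ ℕ) _ ≠ 0
  rw [Finsupp.finsetSum_apply]
  intro h
  have := Finset.sum_eq_zero_iff.mp h i (Finset.mem_univ i)
  rw [Finsupp.mapDomain_apply
    (Submodule.comap_injective_of_surjective (LinearMap.proj_surjective i))] at this
  exact hG this

/-- Powers turn sums of multiplicities into products, so the regrouping by factors does not need
hyperplanes from different factors to be distinct. -/
theorem prod_comap_pi {M : Type*} [CommMonoid M] (B : ∀ i, MultiArrangement K (U i))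
    (g : V →ₗ[K] ∀ i, U i) (hg : Function.Surjective g) (α : Submodule K V → M) :
    ((pi B).comap g hg).mult.prod (fun H n => α H ^ n) =
      ∏ i, (B i).mult.prod
        fun G n => α ((G.comap (LinearMap.proj i)).comap g) ^ n := by
  change ((pi B).mult.mapDomain (Submodule.comap g)).prod _ = _
  rw [Finsupp.prod_mapDomain_index (fun _ => pow_zero _) (fun _ _ _ => pow_add _ _ _)]
  change (∑ i, (B i).mult.mapDomain (Submodule.comap (LinearMap.proj i)) :
    Submodule K (∀ i, U i) →₀ ℕ).prod _ = _
  rw [← Finsupp.prod_finsetSum_index (fun _ => pow_zero _) (fun _ _ _ => pow_add _ _ _)]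
  refine Finset.prod_congr rfl fun i _ => ?_
  rw [Finsupp.prod_mapDomain_index (fun _ => pow_zero _) (fun _ _ _ => pow_add _ _ _)]

/-- A defining polynomial of a product of multi-arrangements in spaces of dimension at most two
has a complete intersection apolar ideal. -/
theorem IsDefiningPolynomial.isCompleteIntersection [CharZero K] {m : Fin k → ℕ}
    (hm : ∀ i, m i = 1 ∨ m i = 2) [Finite τ] (B : ∀ i, MultiArrangement K (Fin (m i) → K))
    (L : (τ → K) ≃ₗ[K] ∀ i, Fin (m i) → K) {f : MvPolynomial τ K}
    (h : ((pi B).comap L.toLinearMap L.surjective).IsDefiningPolynomial f) :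
    IsCompleteIntersection (apolarIdeal f) := by
  classical
  have := Fintype.ofFinite τ
  obtain ⟨d, hd⟩ := h.exists_isHomogeneous
  have h0 := h.ne_zero
  obtain ⟨α, hα, hf⟩ := h
  let L' : (τ → K) ≃ₗ[K] ((Σ i, Fin (m i)) → K) :=
    L.trans (LinearEquiv.piCurry K (fun (i : Fin k) (_ : Fin (m i)) => K)).symm
  let e := linearSubstEquiv L'
  have he : ∀ p, (e (X p)).IsHomogeneous 1 := isHomogeneous_linearSubst_X L'.toLinearMap
  -- Vectors with zero `i`-th component lie in the hyperplane pulled back from `G`. In product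
  -- coordinates its linear form therefore involves only block `i`. Off the arrangement `b` is set
  -- to `0`.
  have hb : ∀ (i : Fin k) (G : Submodule K (Fin (m i) → K)), ∃ b : MvPolynomial (Fin (m i)) K,
      G ∈ (B i).mult.support →
        α ((G.comap (LinearMap.proj i)).comap L.toLinearMap) = e (rename (Sigma.mk i) b) := by
    intro i G
    by_cases hG : G ∈ (B i).mult.support
    · obtain ⟨hl, hz⟩ := hα _ (mem_support_comap_pi B L.toLinearMap L.surjective hG)
      obtain ⟨b, hb⟩ := exists_rename_eq_of_isHomogeneous_one i
        (isHomogeneous_algHom (e := e.symm.toAlgHom) (isHomogeneous_symm_X he) hl) fun w hw => by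
          refine (eval_linearSubstEquiv_symm L' w _).trans ((hz _).mpr ?_)
          have : (L (L'.symm w)) i = 0 := by
            ext p
            have hp := congrFun (L'.apply_symm_apply w) ⟨i, p⟩
            rw [hw p] at hp
            exact hp
          change L (L'.symm w) i ∈ G
          rw [this]
          exact G.zero_mem
      exact ⟨b, fun _ => by rw [← hb]; simp⟩
    · exact ⟨0, fun h => absurd h hG⟩
  choose b hb using hb
  refine isCompleteIntersection_of_eq_prod hm e he
    (fun i => (B i).mult.prod fun G n => b i G ^ n) hd h0 ?_
  refine hf.trans ((prod_comap_pi B L.toLinearMap L.surjective α).trans ?_)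
  refine Finset.prod_congr rfl fun i _ => ?_
  rw [Finsupp.prod, Finsupp.prod, map_prod, map_prod]
  refine Finset.prod_congr rfl fun G hG => ?_
  rw [hb i G hG, map_pow, map_pow]

end MultiArrangement

end

end Apolarity

theorem corollary3p2 {K : Type*} [Field K] [IsAlgClosed K] [CharZero K]
    -- `k` disjoint sets of variables, the `i`-th of size `m i` equal to one or two
    {k : ℕ} (m : Fin k → ℕ) (hm : ∀ i, m i = 1 ∨ m i = 2) {n : ℕ} :
    -- `e` is a graded isomorphism of `K`-algebras `S₁ ⊗ ⋯ ⊗ Sₖ ≅ S`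
    (∀ (e : MvPolynomial (Σ i : Fin k, Fin (m i)) K ≃ₐ[K] MvPolynomial (Fin n) K),
      (∀ p, (e (MvPolynomial.X p)).IsHomogeneous 1) →
      ∀ (g : ∀ i : Fin k, MvPolynomial (Fin (m i)) K) (f : MvPolynomial (Fin n) K) (d : ℕ),
        f.IsHomogeneous d → f ≠ 0 →
        f = ∏ i, e (MvPolynomial.rename (Sigma.mk i) (g i)) →
        Apolarity.IsCompleteIntersection (Apolarity.apolarIdeal f)) ∧
    -- `A` is, after the linear change of coordinates `L`, the product of the `B i`
    (∀ (B : ∀ i : Fin k, Apolarity.MultiArrangement K (Fin (m i) → K))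
      (L : (Fin n → K) ≃ₗ[K] (∀ i : Fin k, Fin (m i) → K))
      (A : Apolarity.MultiArrangement K (Fin n → K)),
      A = (Apolarity.MultiArrangement.pi B).comap L.toLinearMap L.surjective →
      ∀ f : MvPolynomial (Fin n) K, A.IsDefiningPolynomial f →
        Apolarity.IsCompleteIntersection (Apolarity.apolarIdeal f)) := by
  refine ⟨fun e he g f d hf h0 h => Apolarity.isCompleteIntersection_of_eq_prod hm e he g hf h0 h,
    ?_⟩
  rintro B L A rfl f hf
  exact hf.isCompleteIntersection hm B L
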